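/- Let $(M^n,g)$ be a smooth Riemannian manifold without boundary, $n\ge 1$ (not necessarily complete), let $k\in\mathbb R$, let $J\subseteq(0,\infty)$ be open (for instance $J=(0,T)$ with $0<T\le\infty$), and let $u$ be a smooth positive solution of the heat equation $\partial_t u=\Delta u$ on $M\times J$. Put $f=-\ln u$ and, for functions $\alpha(t),\varphi(t)$, $$F=|\nabla f|^2+\alpha(t)f_t-\varphi(t).$$ Here $f_{ij}=\nabla_i\nabla_jf$ is the Hessian of $f$, $\mathrm{Ric}=(R_{ij})$ is the Ricci tensor, repeated indices are contracted with $g$, and $|\cdot|$ is the norm of tensors induced by $g$. The following identities hold on $M\times J$. (1) If $\alpha(t)=1+\frac23kt$ and $\varphi(t)=\frac{n}{2t}+\frac n2k+\frac n6k^2t$, then $$(\Delta-\partial_t)\big(t^2Fu\big)=2t^2\Big|f_{ij}-\frac1{2t}g_{ij}-\frac k2g_{ij}\Big|^2u+2t^2\,(R_{ij}+kg_{ij})f_if_j\,u.$$ (2) If $k\ne0$, $\alpha(t)=1+\frac{\cosh(kt)\sinh(kt)-kt}{\sinh^2(kt)}$ and $\varphi(t)=\frac{nk}{2}\big[\coth(kt)+1\big]$,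 then $$(\Delta-\partial_t)\big(\sinh^2(kt)Fu\big)=2\sinh^2(kt)\Big|f_{ij}-\frac{\varphi}{n}g_{ij}\Big|^2u+2\sinh^2(kt)\,(R_{ij}+kg_{ij})f_if_j\,u.$$ -/

import Mathlib

open scoped Manifold ContDiff

noncomputable section

namespace HeatHarnack

/-- A smooth Riemannian metric on an `n`-dimensional smooth manifold `M` (without boundary). -/
abbrev SmoothMetric (n : ℕ) (M : Type*) [TopologicalSpace M]
    [ChartedSpace (EuclideanSpace ℝ (Fin n)) M] [IsManifold (𝓡 n) ∞ M] :=
  Bundle.ContMDiffRiemannianMetric (𝓡 n) ∞ (EuclideanSpace ℝ (Fin n))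
    (fun x : M => TangentSpace (𝓡 n) x)

/-- The partial derivative `∂_i h` of a function on `ℝⁿ`. -/
def pd {n : ℕ} (i : Fin n) (h : EuclideanSpace ℝ (Fin n) → ℝ) (y : EuclideanSpace ℝ (Fin n)) : ℝ :=
  fderiv ℝ h y (EuclideanSpace.single i 1)

section Coordinates

variable {n : ℕ} {M : Type*} [TopologicalSpace M] [ChartedSpace (EuclideanSpace ℝ (Fin n)) M]

/-- The function `h : M → ℝ` read in the chart around `p`. -/
def inChart (p : M) (h : M → ℝ) (y : EuclideanSpace ℝ (Fin n)) : ℝ :=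
  h ((extChartAt (𝓡 n) p).symm y)

/-- The `i`-th coordinate vector field of the chart around `p`, at the point with
coordinates `y`. -/
def coordVec (p : M) (i : Fin n) (y : EuclideanSpace ℝ (Fin n)) :
    TangentSpace (𝓡 n) ((extChartAt (𝓡 n) p).symm y) :=
  mfderiv 𝓘(ℝ, EuclideanSpace ℝ (Fin n)) (𝓡 n) (extChartAt (𝓡 n) p).symm y
    (EuclideanSpace.single i (1 : ℝ))

variable [IsManifold (𝓡 n) ∞ M] (g : SmoothMetric n M)

/-- The matrix `g_ij` of the metric in the chart around `p`. -/
def metricMatrix (p : M) (y : EuclideanSpace ℝ (Fin n)) : Matrix (Fin n) (Fin n) ℝ :=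
  Matrix.of fun i j => g.inner ((extChartAt (𝓡 n) p).symm y) (coordVec p i y) (coordVec p j y)

/-- The inverse matrix `g^ij`. -/
def metricInv (p : M) (y : EuclideanSpace ℝ (Fin n)) : Matrix (Fin n) (Fin n) ℝ :=
  (metricMatrix g p y)⁻¹

/-- The Christoffel symbols
`Γ^m_ij = (1/2) g^ml (∂_i g_jl + ∂_j g_il - ∂_l g_ij)` in the chart around `p`. -/
def christoffel (p : M) (m i j : Fin n) (y : EuclideanSpace ℝ (Fin n)) : ℝ :=
  (1 / 2) * ∑ l, metricInv g p y m l *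
    (pd i (fun z => metricMatrix g p z j l) y + pd j (fun z => metricMatrix g p z i l) y
      - pd l (fun z => metricMatrix g p z i j) y)

/-- The components
`R_ij = ∂_m Γ^m_ij - ∂_j Γ^m_im + Γ^m_ml Γ^l_ij - Γ^m_jl Γ^l_im`
of the Ricci tensor in the chart around `p` (positive on round spheres). -/
def coordRicci (p : M) (i j : Fin n) (y : EuclideanSpace ℝ (Fin n)) : ℝ :=
  ∑ m, (pd m (christoffel g p m i j) y - pd j (christoffel g p m i m) y)
    + ∑ m, ∑ l, (christoffel g p m m l y * christoffel g p l i j y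
        - christoffel g p m j l y * christoffel g p l i m y)

/-- The components `h_ij = ∂_i ∂_j h - Γ^m_ij ∂_m h` of the Hessian of `h` in the chart
around `p`. -/
def coordHess (p : M) (h : M → ℝ) (i j : Fin n) (y : EuclideanSpace ℝ (Fin n)) : ℝ :=
  pd i (pd j (inChart p h)) y - ∑ m, christoffel g p m i j y * pd m (inChart p h) y

end Coordinates

section AtAPoint

variable {n : ℕ} {M : Type*} [TopologicalSpace M] [ChartedSpace (EuclideanSpace ℝ (Fin n)) M]
  [IsManifold (𝓡 n) ∞ M] (g : SmoothMetric n M)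

/-! Components at the point `x` are taken in the preferred chart around `x`. -/

/-- The components `g_ij` of the metric at `x`. -/
def gLow (x : M) (i j : Fin n) : ℝ := metricMatrix g x (extChartAt (𝓡 n) x x) i j

/-- The components `g^ij` of the inverse metric at `x`. -/
def gUp (x : M) (i j : Fin n) : ℝ := metricInv g x (extChartAt (𝓡 n) x x) i j

/-- The components `R_ij` of the Ricci tensor at `x`. -/
def ricci (x : M) (i j : Fin n) : ℝ := coordRicci g x i j (extChartAt (𝓡 n) x x)

/-- The components `h_ij` of the Hessian of `h` at `x`. -/
def hess (h : M → ℝ) (x : M) (i j : Fin n) : ℝ := coordHess g x h i j (extChartAt (𝓡 n) x x)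

/-- The components `h_i` of the differential of `h` at `x`. -/
def dLow (h : M → ℝ) (x : M) (i : Fin n) : ℝ := pd i (inChart x h) (extChartAt (𝓡 n) x x)

/-- The components `(∇h)^i = g^ij h_j` of the gradient of `h` at `x`. -/
def gradUp (h : M → ℝ) (x : M) (i : Fin n) : ℝ := ∑ j, gUp g x i j * dLow h x j

/-- The Laplace-Beltrami operator `Δ h = g^ij h_ij`. -/
def laplacian (h : M → ℝ) (x : M) : ℝ := ∑ i, ∑ j, gUp g x i j * hess g h x i j

/-- The squared length `|∇h|² = g_ij (∇h)^i (∇h)^j` of the gradient. -/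
def gradNormSq (h : M → ℝ) (x : M) : ℝ :=
  ∑ i, ∑ j, gLow g x i j * gradUp g h x i * gradUp g h x j

/-- The squared norm `|A|² = g^ia g^jb A_ij A_ab` of a `2`-tensor at `x`, given by its
components. -/
def tensorNormSq (x : M) (A : Fin n → Fin n → ℝ) : ℝ :=
  ∑ i, ∑ j, ∑ a, ∑ b, gUp g x i a * gUp g x j b * A i j * A a b

/-- The quadratic form `(Ric + k g)(∇h, ∇h)` at `x`. -/
def ricciShiftGrad (k : ℝ) (h : M → ℝ) (x : M) : ℝ :=
  ∑ i, ∑ j, (ricci g x i j + k * gLow g x i j) * gradUp g h x i * gradUp g h x j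

/-- The operator `(Δ - ∂_t) w` on functions `w(x, t)`. -/
def heatOp (w : M → ℝ → ℝ) (x : M) (t : ℝ) : ℝ :=
  laplacian g (fun z => w z t) x - deriv (w x) t

/-- `u` is a smooth positive solution of the heat equation `(Δ - ∂_t) u = 0` on `M × J`. -/
structure IsPositiveHeatSolution (J : Set ℝ) (u : M → ℝ → ℝ) : Prop where
  smooth : ContMDiffOn ((𝓡 n).prod 𝓘(ℝ, ℝ)) 𝓘(ℝ, ℝ) ∞ (fun q : M × ℝ => u q.1 q.2)
    (Set.univ ×ˢ J)
  pos : ∀ x, ∀ t ∈ J, 0 < u x t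
  heat : ∀ x, ∀ t ∈ J, heatOp g u x t = 0

/-- `f = - ln u`. -/
def potential (u : M → ℝ → ℝ) (x : M) (t : ℝ) : ℝ := -Real.log (u x t)

/-- `F = |∇f|² + α f_t - φ` with `f = - ln u`. -/
def harnackF (α φ : ℝ → ℝ) (u : M → ℝ → ℝ) (x : M) (t : ℝ) : ℝ :=
  gradNormSq g (fun z => potential u z t) x + α t * deriv (potential u x) t - φ t

end AtAPoint

/-- `α(t) = 1 + (2/3) k t`. -/
def alphaLin (k t : ℝ) : ℝ := 1 + 2 / 3 * k * t

/-- `φ(t) = n/(2t) + (n/2) k + (n/6) k² t`. -/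
def phiLin (n : ℕ) (k t : ℝ) : ℝ := n / (2 * t) + n / 2 * k + n / 6 * k ^ 2 * t

/-- `α(t) = 1 + (cosh(kt) sinh(kt) - kt) / sinh²(kt)`. -/
def alphaHyp (k t : ℝ) : ℝ :=
  1 + (Real.cosh (k * t) * Real.sinh (k * t) - k * t) / Real.sinh (k * t) ^ 2

/-- `φ(t) = (nk/2) (coth(kt) + 1)`. -/
def phiHyp (n : ℕ) (k t : ℝ) : ℝ :=
  n * k / 2 * (Real.cosh (k * t) / Real.sinh (k * t) + 1)

end HeatHarnack

end

noncomputable section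

namespace HeatHarnack

open Matrix Finset

/-! Write `W = |∇f|²`. For `u = e^{-f}` the heat equation reads `f_t = Δf - W`. For `S = ψF` the
product rule and `∇u = -u∇f` give `(Δ - ∂_t)(Su) = u (ΔS - 2⟨∇S,∇f⟩ - S_t)`. The operator `Δ -
2⟨∇f,∇·⟩ - ∂_t` annihilates `f_t`, and by Bochner's formula it takes `W` to `2|Hess f|² + 2
Ric(∇f,∇f)`. The time factors contribute `-ψ' W - (ψα)' f_t + (ψφ)'`. Completing the square `|Hess f
- c g|²` requires `-4cψ Δf + 2nc²ψ`, and replacing `Ric` by `Ric + kg` requires `2kψW`. Since `Δf =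
W + f_t`, all of this matches once `ψ' = (4c - 2k)ψ`, `(ψα)' = 4cψ` and `(ψφ)' = 2nc²ψ`. This is
`CoordMetric.heat_harnack`. The two parts of the theorem are two solutions of these equations: `ψ =
t²` with `c = 1/(2t) + k/2`, and `ψ = sinh²(kt)` with `c = φ/n`.

The tensor calculus is algebraic: it takes place in a commutative `ℝ`-algebra with commuting
derivations and an invertible symmetric matrix. It is applied to the smooth functions on a chart
times `J`, where `∂_t` is one more derivation that commutes with the others.

The definitions use at each point the chart preferred there, so `z ↦ F(z,t)` and the heat equation
mix charts. Hence `|∇f|²` and `Δ` must be shown independent of the chart (`map_pairing`, `map_lap`).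
For `Δ` the transformation law of the Christoffel symbols is avoided: `two_hess_grad` writes `Hess
h(∇a,∇b)` through iterated inner products of gradients, which are invariant, and the gradients of
the coordinate functions detect the whole Hessian. The Hessian and Ricci tensors on the right-hand
side are evaluated only at the centre of a chart and need no invariance. -/

/-- A metric in coordinates, over an algebra of functions `R`: commuting coordinate derivations, a
symmetric matrix and its inverse. -/
structure CoordMetric (n : ℕ) (R : Type*) [CommRing R] [Algebra ℝ R] where
  d : Fin n → Derivation ℝ R R
  comm : ∀ i j r, d i (d j r) = d j (d i r)
  G : Matrix (Fin n) (Fin n) R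
  H : Matrix (Fin n) (Fin n) R
  symm : Gᵀ = G
  inv_mul : H * G = 1

/-! ### Riemannian calculus over a ring with derivations -/

namespace CoordMetric

variable {n : ℕ} {R : Type*} [CommRing R] [Algebra ℝ R] (X : CoordMetric n R)

/-- Christoffel symbols. -/
def Γ (m i j : Fin n) : R :=
  algebraMap ℝ R (1 / 2) * ∑ l, X.H m l *
    (X.d i (X.G j l) + X.d j (X.G i l) - X.d l (X.G i j))

/-- Components of the Hessian. -/
def hess (f : R) : Matrix (Fin n) (Fin n) R :=
  Matrix.of fun i j => X.d i (X.d j f) - ∑ m, X.Γ m i j * X.d m f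

/-- Components of the gradient. -/
def grad (f : R) (i : Fin n) : R := ∑ j, X.H i j * X.d j f

/-- The inner product of two gradients. -/
def pairing (a b : R) : R := ∑ i, X.grad a i * X.d i b

/-- The Laplacian. -/
def lap (f : R) : R := ∑ i, ∑ j, X.H i j * X.hess f i j

/-- Components of the Ricci tensor. -/
def ric (i j : Fin n) : R :=
  ∑ m, (X.d m (X.Γ m i j) - X.d j (X.Γ m i m))
    + ∑ m, ∑ l, (X.Γ m m l * X.Γ l i j - X.Γ m j l * X.Γ l i m)

theorem mul_inv : X.G * X.H = 1 := mul_eq_one_comm.mp X.inv_mul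

theorem inv_symm : X.Hᵀ = X.H := by
  have h : X.Hᵀ * X.G = 1 := by
    have := congrArg Matrix.transpose X.mul_inv
    rwa [Matrix.transpose_mul, X.symm, Matrix.transpose_one] at this
  calc X.Hᵀ = X.Hᵀ * (X.G * X.H) := by rw [X.mul_inv, mul_one]
    _ = X.H := by rw [← mul_assoc, h, one_mul]

theorem G_comm (i j : Fin n) : X.G i j = X.G j i := congrFun (congrFun X.symm j) i

theorem H_comm (i j : Fin n) : X.H i j = X.H j i := congrFun (congrFun X.inv_symm j) i

theorem two_half (r : R) : algebraMap ℝ R (1 / 2) * r + algebraMap ℝ R (1 / 2) * r = r := by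
  rw [← add_mul, ← map_add]
  norm_num

theorem Γ_comm (m i j : Fin n) : X.Γ m i j = X.Γ m j i := by
  unfold Γ
  congr 1
  refine sum_congr rfl fun l _ => ?_
  rw [X.G_comm i j]
  ring

theorem hess_comm (f : R) (i j : Fin n) : X.hess f i j = X.hess f j i := by
  simp only [hess, Matrix.of_apply, X.comm i j, X.Γ_comm _ i j]

/-- Contracting with `G` cancels the `H` in `Γ`, which leaves the Christoffel symbols of the first
kind. -/
theorem lower_Γ (a i j : Fin n) :
    ∑ m, X.G a m * X.Γ m i j
      = algebraMap ℝ R (1 / 2) * (X.d i (X.G j a) + X.d j (X.G i a) - X.d a (X.G i j)) := by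
  set w : Fin n → R := fun l => X.d i (X.G j l) + X.d j (X.G i l) - X.d l (X.G i j)
  have h : (fun m => X.Γ m i j) = algebraMap ℝ R (1 / 2) • (X.H *ᵥ w) := rfl
  have h2 : X.G *ᵥ (fun m => X.Γ m i j) = algebraMap ℝ R (1 / 2) • w := by
    rw [h, Matrix.mulVec_smul, Matrix.mulVec_mulVec, X.mul_inv, Matrix.one_mulVec]
  exact congrFun h2 a

/-- Metric compatibility `∇g = 0`: in the sum of the two lowered symbols all but the derivative
along `k` cancels. -/
theorem d_G (k i j : Fin n) :
    X.d k (X.G i j) = ∑ m, X.Γ m k i * X.G m j + ∑ m, X.G i m * X.Γ m k j := by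
  have h : ∑ m, X.Γ m k i * X.G m j = ∑ m, X.G j m * X.Γ m k i :=
    sum_congr rfl fun m _ => by rw [X.G_comm m j, mul_comm]
  rw [h, X.lower_Γ, X.lower_Γ, X.G_comm j i, ← mul_add]
  conv_lhs => rw [← two_half (X.d k (X.G i j)), ← mul_add]
  congr 1
  ring

/-- The connection matrix in the direction `k`. -/
def conn (k : Fin n) : Matrix (Fin n) (Fin n) R := Matrix.of fun m a => X.Γ m k a

theorem d_G_matrix (k : Fin n) :
    X.G.map (X.d k) = (X.conn k)ᵀ * X.G + X.G * X.conn k := by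
  ext i j
  simp [Matrix.mul_apply, conn, X.d_G k i j]

theorem map_mul_derivation (D : Derivation ℝ R R) (A B : Matrix (Fin n) (Fin n) R) :
    (A * B).map D = A.map D * B + A * B.map D := by
  ext i j
  simp [Matrix.mul_apply, sum_add_distrib, add_comm, mul_comm]

/-- Differentiate `H * G = 1` and solve for the derivative of `H`. -/
theorem d_H_matrix (k : Fin n) :
    X.H.map (X.d k) = - (X.H * (X.conn k)ᵀ + X.conn k * X.H) := by
  have h := map_mul_derivation (X.d k) X.H X.G
  have h1 : (1 : Matrix (Fin n) (Fin n) R).map (X.d k) = 0 := by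
    ext i j
    by_cases hij : i = j <;> simp [hij]
  rw [X.inv_mul, h1, X.d_G_matrix] at h
  have h2 : X.H.map (X.d k) * X.G * X.H
      = - (X.H * ((X.conn k)ᵀ * X.G + X.G * X.conn k)) * X.H := by
    rw [eq_neg_of_add_eq_zero_left h.symm]
  rw [mul_assoc, X.mul_inv, mul_one] at h2
  rw [h2, neg_mul]
  congr 1
  rw [mul_add, add_mul, ← mul_assoc X.H X.G, X.inv_mul, one_mul, mul_assoc, mul_assoc,
    X.mul_inv, mul_one]

theorem d_H (k i j : Fin n) :
    X.d k (X.H i j) = - (∑ a, X.H i a * X.Γ j k a + ∑ a, X.Γ i k a * X.H a j) := by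
  simpa [Matrix.mul_apply, conn] using congrFun (congrFun (X.d_H_matrix k) i) j

/-- The covariant derivative `∇_i V^l` of a vector field. -/
def cov (V : Fin n → R) : Matrix (Fin n) (Fin n) R :=
  Matrix.of fun l i => X.d i (V l) + ∑ a, X.Γ l i a * V a

/-- The covariant derivative of the gradient is the Hessian with an index raised. -/
theorem cov_grad (f : R) : X.cov (X.grad f) = X.H * X.hess f := by
  ext l i
  have h1 : ∑ k, (∑ a, X.H l a * X.Γ k i a) * X.d k f
      = ∑ k, X.H l k * ∑ m, X.Γ m k i * X.d m f := by
    simp only [sum_mul, mul_sum]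
    rw [sum_comm]
    refine sum_congr rfl fun a _ => sum_congr rfl fun b _ => ?_
    rw [X.Γ_comm b i a, mul_assoc]
  have h2 : ∑ k, (∑ a, X.Γ l i a * X.H a k) * X.d k f
      = ∑ a, X.Γ l i a * ∑ k, X.H a k * X.d k f := by
    simp only [sum_mul, mul_sum]
    rw [sum_comm]
    simp only [mul_assoc]
  simp only [cov, grad, hess, Matrix.mul_apply, Matrix.of_apply, map_sum, Derivation.leibniz,
    smul_eq_mul, sum_add_distrib, mul_sub, sum_sub_distrib]
  have h3 : ∑ k, X.d k f * X.d i (X.H l k)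
      = - (∑ k, (∑ a, X.H l a * X.Γ k i a) * X.d k f)
        - ∑ k, (∑ a, X.Γ l i a * X.H a k) * X.d k f := by
    rw [← sum_neg_distrib, ← sum_sub_distrib]
    refine sum_congr rfl fun k _ => ?_
    rw [X.d_H]
    ring
  rw [h3, h1, h2]
  simp only [X.comm i]
  ring

theorem lap_eq_trace (f : R) : X.lap f = (X.H * X.hess f).trace := by
  simp only [lap, Matrix.trace, Matrix.diag_apply, Matrix.mul_apply]
  refine sum_congr rfl fun i _ => sum_congr rfl fun j _ => ?_
  rw [X.hess_comm]

theorem pairing_eq (a b : R) : X.pairing a b = ∑ i, ∑ j, X.H i j * X.d i a * X.d j b := by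
  simp only [pairing, grad, sum_mul]
  rw [sum_comm]
  refine sum_congr rfl fun i _ => sum_congr rfl fun j _ => ?_
  rw [X.H_comm]

theorem pairing_comm (a b : R) : X.pairing a b = X.pairing b a := by
  rw [pairing_eq, pairing_eq, sum_comm]
  refine sum_congr rfl fun i _ => sum_congr rfl fun j _ => ?_
  rw [X.H_comm]
  ring

theorem d_grad (f : R) (l i : Fin n) :
    X.d i (X.grad f l) = (X.H * X.hess f) l i - ∑ a, X.Γ l i a * X.grad f a := by
  rw [← X.cov_grad]
  simp [cov]

/-- Product rule for `⟨∇a,∇b⟩`: the Christoffel terms from the gradient of `a` cancel those in the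
Hessian of `b`. -/
theorem d_pairing (k : Fin n) (a b : R) :
    X.d k (X.pairing a b)
      = ∑ i, X.hess a k i * X.grad b i + ∑ i, X.hess b k i * X.grad a i := by
  have h1 : ∑ i, X.hess a k i * X.grad b i = ∑ i, (X.H * X.hess a) i k * X.d i b := by
    simp only [grad, Matrix.mul_apply, mul_sum, sum_mul]
    rw [sum_comm]
    refine sum_congr rfl fun i _ => sum_congr rfl fun j _ => ?_
    rw [X.H_comm i j, X.hess_comm a j k]
    ring
  have h2 : ∑ i, X.hess b k i * X.grad a i
      = ∑ i, X.grad a i * X.d k (X.d i b) - ∑ i, (∑ m, X.Γ i k m * X.grad a m) * X.d i b := by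
    simp only [hess, Matrix.of_apply, sub_mul, sum_sub_distrib, sum_mul]
    congr 1
    · exact sum_congr rfl fun i _ => mul_comm _ _
    · rw [sum_comm]
      exact sum_congr rfl fun i _ => sum_congr rfl fun j _ => by ring
  rw [h1, h2]
  simp only [pairing, map_sum, Derivation.leibniz, smul_eq_mul, sum_add_distrib, X.d_grad,
    mul_sub, sum_sub_distrib]
  simp only [mul_comm (X.d _ b)]
  ring

theorem pairing_pairing (a h b : R) :
    X.pairing a (X.pairing h b)
      = ∑ k, ∑ i, X.hess h k i * X.grad a k * X.grad b i
        + ∑ k, ∑ i, X.hess b k i * X.grad a k * X.grad h i := by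
  simp only [pairing, ← sum_add_distrib]
  refine sum_congr rfl fun k _ => ?_
  have := X.d_pairing k h b
  simp only [pairing] at this
  rw [this, mul_add, mul_sum, mul_sum, ← sum_add_distrib]
  exact sum_congr rfl fun i _ => by ring

theorem hess_swap (h a b : R) :
    ∑ k, ∑ i, X.hess h k i * X.grad a k * X.grad b i
      = ∑ k, ∑ i, X.hess h k i * X.grad b k * X.grad a i := by
  rw [sum_comm]
  refine sum_congr rfl fun i _ => sum_congr rfl fun j _ => ?_
  rw [X.hess_comm]
  ring

/-- The Hessian on gradients, expressed through the pairing alone. -/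
theorem two_hess_grad (h a b : R) :
    2 * ∑ k, ∑ i, X.hess h k i * X.grad a k * X.grad b i
      = X.pairing a (X.pairing h b) + X.pairing b (X.pairing h a)
        - X.pairing h (X.pairing a b) := by
  simp only [pairing_pairing]
  rw [X.hess_swap h b a, X.hess_swap b a h, X.hess_swap a b h]
  ring

/-- The divergence of a vector field. -/
def div (V : Fin n → R) : R := (X.cov V).trace

theorem lap_eq_div (f : R) : X.lap f = X.div (X.grad f) := by
  rw [lap_eq_trace, div, cov_grad]

theorem div_eq (V : Fin n → R) : X.div V = ∑ l, (X.d l (V l) + ∑ a, X.Γ l l a * V a) := rfl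

/-- Commutation of covariant derivatives of a vector field, traced. -/
theorem div_cov (V : Fin n → R) (i : Fin n) :
    ∑ l, X.d l (X.cov V l i) + ∑ m, ∑ l, X.Γ m m l * X.cov V l i
      - ∑ l, ∑ a, X.Γ a l i * X.cov V l a
      = X.d i (X.div V) + ∑ a, X.ric a i * V a := by
  have e1 : ∑ m, ∑ l, X.Γ m m l * X.cov V l i
      = ∑ m, ∑ l, X.Γ m m l * X.d i (V l)
        + ∑ a, ∑ m, ∑ l, X.Γ m m l * X.Γ l a i * V a := by
    simp only [cov, Matrix.of_apply, mul_add, sum_add_distrib, mul_sum]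
    congr 1
    rw [sum_comm]
    have : ∀ l, ∑ m, ∑ a, X.Γ m m l * (X.Γ l i a * V a)
        = ∑ a, ∑ m, X.Γ m m l * X.Γ l a i * V a := by
      intro l
      rw [sum_comm]
      exact sum_congr rfl fun a _ => sum_congr rfl fun m _ => by rw [X.Γ_comm l i a]; ring
    simp only [this]
    rw [sum_comm]
    exact sum_congr rfl fun a _ => sum_comm
  have e2 : ∑ l, ∑ a, X.Γ a l i * X.cov V l a
      = ∑ l, ∑ a, X.Γ a l i * X.d a (V l)
        + ∑ a, ∑ m, ∑ l, X.Γ m i l * X.Γ l a m * V a := by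
    simp only [cov, Matrix.of_apply, mul_add, sum_add_distrib, mul_sum]
    congr 1
    have : ∀ l, ∑ m, ∑ a, X.Γ m l i * (X.Γ l m a * V a)
        = ∑ a, ∑ m, X.Γ m i l * X.Γ l a m * V a := by
      intro l
      rw [sum_comm]
      exact sum_congr rfl fun a _ => sum_congr rfl fun m _ => by
        rw [X.Γ_comm m l i, X.Γ_comm l m a]; ring
    simp only [this]
    rw [sum_comm]
    exact sum_congr rfl fun a _ => sum_comm
  have e3 : ∑ l, ∑ a, X.Γ l i a * X.d l (V a) = ∑ l, ∑ a, X.Γ a l i * X.d a (V l) := by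
    rw [sum_comm]
    exact sum_congr rfl fun a _ => sum_congr rfl fun l _ => by rw [X.Γ_comm l i a]
  -- The four sums making up Ricci: the first two come from differentiating `Γ` in `∇V` and in `div
  -- V`, the last two are the quadratic terms of `e1` and `e2`.
  have e4 : ∑ a, X.ric a i * V a
      = ∑ a, ∑ m, X.d m (X.Γ m a i) * V a - ∑ a, ∑ m, X.d i (X.Γ m a m) * V a
        + ∑ a, ∑ m, ∑ l, X.Γ m m l * X.Γ l a i * V a
        - ∑ a, ∑ m, ∑ l, X.Γ m i l * X.Γ l a m * V a := by
    simp only [ric, add_mul, sum_mul, sub_mul, sum_add_distrib, sum_sub_distrib]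
    ring
  rw [e1, e2, e4]
  simp only [cov, div_eq, Matrix.of_apply, map_add, map_sum, Derivation.leibniz, smul_eq_mul,
    sum_add_distrib]
  rw [e3]
  have e5 : ∑ l, ∑ a, V a * X.d l (X.Γ l i a) = ∑ a, ∑ m, X.d m (X.Γ m a i) * V a := by
    rw [sum_comm]
    exact sum_congr rfl fun a _ => sum_congr rfl fun l _ => by rw [X.Γ_comm l i a, mul_comm]
  have e6 : ∑ l, ∑ a, V a * X.d i (X.Γ l l a) = ∑ a, ∑ m, X.d i (X.Γ m a m) * V a := by
    rw [sum_comm]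
    exact sum_congr rfl fun a _ => sum_congr rfl fun l _ => by rw [X.Γ_comm l l a, mul_comm]
  rw [e5, e6]
  -- The second derivatives of `V` cancel because the coordinate derivations commute.
  simp only [X.comm i]
  ring

/-! ### Bochner's formula and product rules for the Laplacian -/

/-- Bochner's formula. -/
theorem bochner (f : R) :
    X.lap (X.pairing f f)
      = 2 * ((X.H * X.hess f) * (X.H * X.hess f)).trace
        + 2 * X.pairing f (X.lap f)
        + 2 * ∑ i, ∑ j, X.ric i j * X.grad f i * X.grad f j := by
  set A := X.H * X.hess f with hA
  have hgrad : ∀ l, X.grad (X.pairing f f) l = 2 * ∑ i, A l i * X.grad f i := by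
    intro l
    have : ∀ k, X.d k (X.pairing f f) = 2 * ∑ i, X.hess f k i * X.grad f i := fun k => by
      rw [X.d_pairing]; ring
    rw [grad]
    simp only [this, hA, Matrix.mul_apply, mul_sum, sum_mul]
    rw [sum_comm]
    exact sum_congr rfl fun a _ => sum_congr rfl fun l _ => by ring
  have hcov : X.cov (X.grad f) = A := X.cov_grad f
  have hcomm := fun i => X.div_cov (X.grad f) i
  rw [hcov, ← X.lap_eq_div] at hcomm
  -- The traced commutation formula for `V = ∇f`, contracted once more with `∇f`; here `div V = Δf`.
  have key : ∑ i, X.grad f i * (∑ l, X.d l (A l i) + ∑ m, ∑ l, X.Γ m m l * A l i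
      - ∑ l, ∑ a, X.Γ a l i * A l a)
      = X.pairing f (X.lap f) + ∑ i, ∑ j, X.ric i j * X.grad f i * X.grad f j := by
    simp only [hcomm, mul_add, sum_add_distrib, mul_sum]
    congr 1
    rw [sum_comm]
    exact sum_congr rfl fun a _ => sum_congr rfl fun l _ => by ring
  -- `Δ|∇f|²` is the divergence of `2A∇f`. Differentiating `∇f` gives `tr A²` (`p1`) and a
  -- Christoffel term (`p2`); differentiating `A` gives the left side of `key`.
  rw [X.lap_eq_div (X.pairing f f), div_eq]
  have htwo : ∀ (D : Derivation ℝ R R) (r : R), D (2 * r) = 2 * D r := fun D r => by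
    rw [two_mul, map_add, two_mul]
  simp only [hgrad, htwo, map_sum, Derivation.leibniz, smul_eq_mul, X.d_grad, ← hA]
  have p1 : ∑ l, ∑ i, A l i * A i l = (A * A).trace := by
    simp only [Matrix.trace, Matrix.diag_apply, Matrix.mul_apply]
  have p2 : ∑ l, ∑ i, A l i * ∑ a, X.Γ i l a * X.grad f a
      = ∑ i, X.grad f i * ∑ l, ∑ a, X.Γ a l i * A l a := by
    simp only [mul_sum]
    rw [sum_congr rfl fun l _ => sum_comm, sum_comm]
    exact sum_congr rfl fun a _ => sum_congr rfl fun l _ => sum_congr rfl fun i _ => by ring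
  have p3 : ∑ l, ∑ i, X.grad f i * X.d l (A l i) = ∑ i, X.grad f i * ∑ l, X.d l (A l i) := by
    simp only [mul_sum]
    rw [sum_comm]
  have p4 : ∑ l, ∑ a, X.Γ l l a * (2 * ∑ i, A a i * X.grad f i)
      = 2 * ∑ i, X.grad f i * ∑ m, ∑ l, X.Γ m m l * A l i := by
    simp only [mul_sum]
    rw [sum_congr rfl fun l _ => sum_comm, sum_comm]
    exact sum_congr rfl fun a _ => sum_congr rfl fun l _ => sum_congr rfl fun i _ => by ring
  have key2 := key
  simp only [mul_sub, mul_add, sum_add_distrib, sum_sub_distrib] at key2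
  simp only [← mul_sum, mul_sub, sum_add_distrib, sum_sub_distrib, p1, p2, p3, p4]
  linear_combination 2 * key2

theorem hess_add (a b : R) : X.hess (a + b) = X.hess a + X.hess b := by
  ext i j
  simp only [hess, Matrix.of_apply, Matrix.add_apply, map_add, mul_add, sum_add_distrib]
  ring

theorem hess_mul (a b : R) (i j : Fin n) :
    X.hess (a * b) i j = a * X.hess b i j + b * X.hess a i j
      + X.d i a * X.d j b + X.d i b * X.d j a := by
  simp only [hess, Matrix.of_apply, map_add, Derivation.leibniz, smul_eq_mul, mul_add,
    sum_add_distrib, mul_sub, mul_sum]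
  simp only [mul_left_comm (X.Γ _ _ _)]
  ring

theorem lap_add (a b : R) : X.lap (a + b) = X.lap a + X.lap b := by
  simp only [lap, hess_add, Matrix.add_apply, mul_add, sum_add_distrib]

theorem lap_mul (a b : R) :
    X.lap (a * b) = a * X.lap b + b * X.lap a + 2 * X.pairing a b := by
  have h : ∑ i, ∑ j, X.H i j * X.d i b * X.d j a = X.pairing a b := by
    rw [X.pairing_comm, pairing_eq]
  rw [two_mul]
  nth_rw 2 [← h]
  rw [pairing_eq]
  simp only [lap, hess_mul, mul_sum, ← sum_add_distrib]
  exact sum_congr rfl fun i _ => sum_congr rfl fun j _ => by ring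

theorem lap_sub (a b : R) : X.lap (a - b) = X.lap a - X.lap b := by
  rw [eq_sub_iff_add_eq, ← lap_add, sub_add_cancel]

theorem lower_grad (f : R) (i : Fin n) : ∑ j, X.G i j * X.grad f j = X.d i f := by
  have h : X.grad f = X.H *ᵥ fun j => X.d j f := rfl
  change (X.G *ᵥ X.grad f) i = _
  rw [h, Matrix.mulVec_mulVec, X.mul_inv, Matrix.one_mulVec]

/-- The inner product of gradients in terms of the metric. -/
theorem pairing_eq_G (f : R) :
    X.pairing f f = ∑ i, ∑ j, X.G i j * X.grad f i * X.grad f j := by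
  simp only [pairing, ← X.lower_grad f, mul_sum]
  exact sum_congr rfl fun i _ => sum_congr rfl fun j _ => by ring

/-- Spatially constant elements. -/
theorem lap_const {a : R} (ha : ∀ i, X.d i a = 0) : X.lap a = 0 := by
  simp [lap, hess, ha]

theorem pairing_const {a : R} (ha : ∀ i, X.d i a = 0) (b : R) : X.pairing a b = 0 := by
  simp [pairing_eq, ha]

theorem lap_const_mul {a : R} (ha : ∀ i, X.d i a = 0) (b : R) : X.lap (a * b) = a * X.lap b := by
  rw [lap_mul, X.lap_const ha, X.pairing_const ha]
  ring

theorem pairing_add (a b c : R) : X.pairing a (b + c) = X.pairing a b + X.pairing a c := by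
  simp only [pairing, map_add, mul_add, sum_add_distrib]

theorem pairing_sub (a b c : R) : X.pairing a (b - c) = X.pairing a b - X.pairing a c := by
  simp only [pairing, map_sub, mul_sub, sum_sub_distrib]

theorem pairing_mul (a b c : R) :
    X.pairing a (b * c) = b * X.pairing a c + c * X.pairing a b := by
  simp only [pairing, Derivation.leibniz, smul_eq_mul, mul_add, sum_add_distrib, mul_sum]
  congr 1 <;> exact sum_congr rfl fun i _ => by ring

/-! ### Time derivatives -/

section Time

variable {D : Derivation ℝ R R}

/-- The metric is static, so `D` kills everything built from it and passes through all the spatial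
operators. -/
theorem D_Γ (hD : ∀ i r, D (X.d i r) = X.d i (D r)) (hG : ∀ i j, D (X.G i j) = 0)
    (hH : ∀ i j, D (X.H i j) = 0) (m i j : Fin n) : D (X.Γ m i j) = 0 := by
  simp [Γ, hD, hG, hH]

theorem D_hess (hD : ∀ i r, D (X.d i r) = X.d i (D r)) (hG : ∀ i j, D (X.G i j) = 0)
    (hH : ∀ i j, D (X.H i j) = 0) (f : R) (i j : Fin n) :
    D (X.hess f i j) = X.hess (D f) i j := by
  simp [hess, hD, X.D_Γ hD hG hH]

theorem D_lap (hD : ∀ i r, D (X.d i r) = X.d i (D r)) (hG : ∀ i j, D (X.G i j) = 0)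
    (hH : ∀ i j, D (X.H i j) = 0) (f : R) : D (X.lap f) = X.lap (D f) := by
  simp [lap, X.D_hess hD hG hH, hH]

theorem D_pairing (hD : ∀ i r, D (X.d i r) = X.d i (D r))
    (hH : ∀ i j, D (X.H i j) = 0) (f : R) : D (X.pairing f f) = 2 * X.pairing f (D f) := by
  have h : D (X.pairing f f) = X.pairing (D f) f + X.pairing f (D f) := by
    simp only [pairing_eq, map_sum, Derivation.leibniz, hH, hD, smul_eq_mul, ← sum_add_distrib]
    exact sum_congr rfl fun i _ => sum_congr rfl fun j _ => by ring
  rw [h, X.pairing_comm (D f)]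
  ring

end Time

/-! ### Completing the square and the evolution identity -/

/-- The squared norm of a `2`-tensor. -/
def normSq (A : Matrix (Fin n) (Fin n) R) : R :=
  ∑ i, ∑ j, ∑ a, ∑ b, X.H i a * X.H j b * A i j * A a b

/-- Symmetry of `A` and `H` puts the indices in cyclic order, so the norm becomes the trace of the
square of an endomorphism. -/
theorem normSq_eq_trace {A : Matrix (Fin n) (Fin n) R} (hA : Aᵀ = A) :
    X.normSq A = ((X.H * A) * (X.H * A)).trace := by
  have hA' : ∀ i j, A i j = A j i := fun i j => congrFun (congrFun hA j) i
  simp only [normSq, Matrix.trace, Matrix.diag_apply, Matrix.mul_apply, sum_mul_sum]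
  refine sum_congr rfl fun i _ => ?_
  rw [sum_congr rfl fun j _ => sum_comm, sum_comm, sum_congr rfl fun b _ => sum_comm]
  refine sum_congr rfl fun b _ => sum_congr rfl fun a _ => sum_congr rfl fun j _ => ?_
  rw [X.H_comm j b, hA' i j]
  ring

theorem normSq_hess_sub (f c : R) :
    X.normSq (X.hess f - c • X.G)
      = ((X.H * X.hess f) * (X.H * X.hess f)).trace - 2 * c * X.lap f + n * c ^ 2 := by
  have hs : (X.hess f)ᵀ = X.hess f := by
    ext i j
    exact X.hess_comm f j i
  rw [X.normSq_eq_trace (by rw [Matrix.transpose_sub, Matrix.transpose_smul, X.symm, hs]),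
    lap_eq_trace, mul_sub, Matrix.mul_smul, X.inv_mul]
  simp only [mul_sub, sub_mul, Matrix.trace_sub, Matrix.mul_smul, Matrix.smul_mul, mul_one,
    one_mul, Matrix.trace_smul, Matrix.trace_one, smul_eq_mul, Fintype.card_fin]
  ring

/-- The relation `du = -u df` stands in for `u = e^{-f}`, so no exponential is needed in the ring.
-/
theorem lap_exp_neg {u f : R} (h : ∀ i, X.d i u = -(u * X.d i f)) :
    X.lap u = u * (X.pairing f f - X.lap f) := by
  have hh : ∀ i j, X.hess u i j = u * X.d i f * X.d j f - u * X.hess f i j := by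
    intro i j
    simp only [hess, Matrix.of_apply, h, map_neg, Derivation.leibniz, smul_eq_mul, mul_neg,
      sum_neg_distrib, mul_sub, mul_sum]
    simp only [mul_left_comm (X.Γ _ _ _)]
    ring
  simp only [lap, pairing_eq, hh, mul_sub, sum_sub_distrib, mul_sum]
  congr 1 <;> exact sum_congr rfl fun i _ => sum_congr rfl fun j _ => by ring

theorem pairing_exp_neg {u f : R} (h : ∀ i, X.d i u = -(u * X.d i f)) (a : R) :
    X.pairing a u = - (u * X.pairing a f) := by
  simp only [pairing, h, mul_sum, ← sum_neg_distrib]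
  exact sum_congr rfl fun i _ => by ring

/-- The evolution of the Harnack quantity `F = |∇f|² + α f_t - φ` for a solution `u = exp (-f)`
of the heat equation. -/
theorem heat_harnack {D : Derivation ℝ R R} (hD : ∀ i r, D (X.d i r) = X.d i (D r))
    (hG : ∀ i j, D (X.G i j) = 0) (hH : ∀ i j, D (X.H i j) = 0)
    {u f : R} (hu : ∀ i, X.d i u = -(u * X.d i f)) (hut : D u = -(u * D f))
    (hf : D f = X.lap f - X.pairing f f)
    {ψ α φ c k : R} (hψ : ∀ i, X.d i ψ = 0) (hα : ∀ i, X.d i α = 0) (hφ : ∀ i, X.d i φ = 0)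
    (hDψ : D ψ = ψ * (4 * c - 2 * k)) (hDψα : D (ψ * α) = 4 * c * ψ)
    (hDψφ : D (ψ * φ) = 2 * n * c ^ 2 * ψ) :
    X.lap (ψ * (X.pairing f f + α * D f - φ) * u)
        - D (ψ * (X.pairing f f + α * D f - φ) * u)
      = 2 * ψ * X.normSq (X.hess f - c • X.G) * u
        + 2 * ψ * (∑ i, ∑ j, (X.ric i j + k * X.G i j) * X.grad f i * X.grad f j) * u := by
  have hlapu := X.lap_exp_neg hu
  have hb := X.bochner f
  have hW := X.D_pairing hD hH f
  have hDD : D (D f) = X.lap (D f) - 2 * X.pairing f (D f) := by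
    conv_lhs => rw [hf]
    rw [map_sub, X.D_lap hD hG hH, hW]
  have hfW : X.pairing f (D f) = X.pairing f (X.lap f) - X.pairing f (X.pairing f f) := by
    conv_lhs => rw [hf]
    rw [pairing_sub]
  have hα' : ∀ i, X.d i (ψ * α) = 0 := fun i => by simp [hψ, hα]
  have hφ' : ∀ i, X.d i (ψ * φ) = 0 := fun i => by simp [hψ, hφ]
  -- `S = ψF`, grouped by `ψ`, `ψα` and `ψφ`, whose time derivatives are the prescribed ones.
  obtain ⟨S, hS⟩ : ∃ S, S = ψ * X.pairing f f + (ψ * α) * D f - ψ * φ := ⟨_, rfl⟩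
  have hsplit : ψ * (X.pairing f f + α * D f - φ) = S := by rw [hS]; ring
  have hlS : X.lap S = ψ * X.lap (X.pairing f f) + (ψ * α) * X.lap (D f) := by
    rw [hS, lap_sub, lap_add, X.lap_const_mul hψ, X.lap_const_mul hα', X.lap_const hφ', sub_zero]
  have hpS : X.pairing S f
      = ψ * X.pairing f (X.pairing f f) + (ψ * α) * X.pairing f (D f) := by
    rw [hS, pairing_comm, pairing_sub, pairing_add, pairing_mul, pairing_mul, X.pairing_comm f ψ,
      X.pairing_comm f (ψ * α), X.pairing_comm f (ψ * φ), X.pairing_const hψ,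
      X.pairing_const hα', X.pairing_const hφ']
    ring
  have hDS : D S = ψ * D (X.pairing f f) + X.pairing f f * D ψ + (ψ * α) * D (D f)
      + D f * D (ψ * α) - D (ψ * φ) := by
    rw [hS, map_sub, map_add, Derivation.leibniz D ψ (X.pairing f f),
      Derivation.leibniz D (ψ * α) (D f)]
    simp only [smul_eq_mul]
    ring
  have hk : ∑ i, ∑ j, (X.ric i j + k * X.G i j) * X.grad f i * X.grad f j
      = ∑ i, ∑ j, X.ric i j * X.grad f i * X.grad f j + k * X.pairing f f := by
    rw [X.pairing_eq_G]
    simp only [add_mul, sum_add_distrib, mul_sum]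
    congr 1
    exact sum_congr rfl fun i _ => sum_congr rfl fun j _ => by ring
  have hDu : D (S * u) = S * D u + u * D S := by simp [Derivation.leibniz]
  rw [hsplit, X.normSq_hess_sub, hk, lap_mul, X.pairing_exp_neg hu, hlapu, hDu, hDS, hlS, hpS,
    hDψ, hDψα, hDψφ, hut, hDD, hW, hfW, hb]
  -- The equation for `f` enters twice more: with factor `uS` it says `Δu = u_t`, and with factor
  -- `-4ψcu` it replaces `W + f_t` by `Δf` in the cross term of the square.
  linear_combination (u * S - 4 * ψ * c * u) * hf
end CoordMetric

/-! ### Behaviour under changes of coordinates -/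

namespace CoordMetric

variable {n : ℕ} {R S : Type*} [CommRing R] [Algebra ℝ R] [CommRing S] [Algebra ℝ S]

theorem two_mul_cancel {a b : R} (h : 2 * a = 2 * b) : a = b := by
  have := congrArg (fun r => algebraMap ℝ R (1 / 2) * r) h
  simpa only [two_mul, mul_add, two_half] using this

/-- A change of coordinates with Jacobian matrix `J`. -/
structure IsCoordChange (X : CoordMetric n R) (Y : CoordMetric n S) (T : S →+* R)
    (J : Matrix (Fin n) (Fin n) R) : Prop where
  chain : ∀ i s, X.d i (T s) = ∑ a, J a i * T (Y.d a s)
  metric : X.G = Jᵀ * T.mapMatrix Y.G * J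

namespace IsCoordChange

variable {X : CoordMetric n R} {Y : CoordMetric n S} {T : S →+* R}
  {J : Matrix (Fin n) (Fin n) R}

/-- Invertibility of `J` is not assumed: the law for `G` gives `H Jᵀ G' J = 1`, which makes `J`
invertible and identifies the inverse of `G'`. -/
theorem map_H (h : IsCoordChange X Y T J) : T.mapMatrix Y.H = J * X.H * Jᵀ := by
  have h1 : (X.H * Jᵀ * T.mapMatrix Y.G) * J = 1 := by
    rw [← X.inv_mul, h.metric]
    simp only [mul_assoc]
  have h2 : J * X.H * Jᵀ * T.mapMatrix Y.G = 1 := by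
    rw [← mul_eq_one_comm.mp h1]
    simp only [mul_assoc]
  calc T.mapMatrix Y.H = (J * X.H * Jᵀ * T.mapMatrix Y.G) * T.mapMatrix Y.H := by
        rw [h2, one_mul]
    _ = J * X.H * Jᵀ := by
        rw [mul_assoc, ← map_mul, Y.mul_inv, map_one, mul_one]

theorem pairing_eq_dotProduct (X : CoordMetric n R) (a b : R) :
    X.pairing a b = (fun i => X.d i a) ⬝ᵥ (X.H *ᵥ fun i => X.d i b) := by
  simp only [pairing_eq, dotProduct, mulVec, mul_sum]
  exact sum_congr rfl fun i _ => sum_congr rfl fun j _ => by ring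

/-- Differentials transform by `Jᵀ`, the inverse metric by `J · Jᵀ`; the factors match. -/
theorem map_pairing (h : IsCoordChange X Y T J) (a b : S) :
    T (Y.pairing a b) = X.pairing (T a) (T b) := by
  have hc : ∀ s, (fun i => X.d i (T s)) = Jᵀ *ᵥ fun i => T (Y.d i s) := fun s => by
    ext i
    exact h.chain i s
  have hl : T (Y.pairing a b)
      = (fun i => T (Y.d i a)) ⬝ᵥ (T.mapMatrix Y.H *ᵥ fun i => T (Y.d i b)) := by
    simp [pairing_eq_dotProduct, dotProduct, mulVec]
  rw [hl, pairing_eq_dotProduct, hc, hc, h.map_H, Matrix.mulVec_transpose J,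
    ← Matrix.dotProduct_mulVec, Matrix.mulVec_mulVec, Matrix.mulVec_mulVec, mul_assoc]

/-- The Laplacian does not depend on the coordinates. -/
theorem map_lap (h : IsCoordChange X Y T J) {y : Fin n → S}
    (hy : ∀ i a, Y.d i (y a) = if i = a then 1 else 0) (s : S) :
    T (Y.lap s) = X.lap (T s) := by
  have hgY : ∀ a i, Y.grad (y a) i = Y.H i a := fun a i => by simp [grad, hy]
  have hdX : ∀ a i, X.d i (T (y a)) = J a i := fun a i => by
    rw [h.chain]
    simp [hy, apply_ite T]
  have hgX : ∀ a i, X.grad (T (y a)) i = (X.H * Jᵀ) i a := fun a i => by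
    simp [grad, hdX, Matrix.mul_apply]
  -- Entry `(a, b)` on either side is the Hessian evaluated on the gradients of the coordinate
  -- functions `y a` and `y b`, hence a combination of iterated pairings, which `T` preserves.
  have key : T.mapMatrix (Y.H * Y.hess s * Y.H) = J * X.H * X.hess (T s) * (X.H * Jᵀ) := by
    ext a b
    have e1 : T.mapMatrix (Y.H * Y.hess s * Y.H) a b
        = T (∑ k, ∑ i, Y.hess s k i * Y.grad (y a) k * Y.grad (y b) i) := by
      simp only [hgY, RingHom.mapMatrix_apply, Matrix.map_apply, Matrix.mul_apply, sum_mul]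
      rw [sum_comm]
      congr 1
      exact sum_congr rfl fun i _ => sum_congr rfl fun j _ => by rw [Y.H_comm a i]; ring
    have e2 : (J * X.H * X.hess (T s) * (X.H * Jᵀ)) a b
        = ∑ k, ∑ i, X.hess (T s) k i * X.grad (T (y a)) k * X.grad (T (y b)) i := by
      have ht : ∀ k, (J * X.H) a k = (X.H * Jᵀ) k a := fun k => by
        have : (X.H * Jᵀ)ᵀ = J * X.H := by
          rw [Matrix.transpose_mul, Matrix.transpose_transpose, X.inv_symm]
        rw [← this, Matrix.transpose_apply]
      rw [Matrix.mul_apply]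
      simp only [Matrix.mul_apply (M := J * X.H), hgX, ht, sum_mul]
      rw [sum_comm]
      exact sum_congr rfl fun i _ => sum_congr rfl fun j _ => by ring
    rw [e1, e2]
    apply two_mul_cancel
    rw [two_hess_grad, ← h.map_pairing, ← h.map_pairing, ← h.map_pairing, ← h.map_pairing,
      ← h.map_pairing, ← h.map_pairing, ← map_ofNat T 2, ← map_mul, two_hess_grad]
    simp
  have hl : T (Y.lap s) = (T.mapMatrix (Y.H * Y.hess s * Y.H) * T.mapMatrix Y.G).trace := by
    rw [← map_mul, mul_assoc, Y.inv_mul, mul_one, lap_eq_trace, RingHom.mapMatrix_apply]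
    simp only [Matrix.trace, Matrix.diag_apply, Matrix.map_apply, map_sum]
  rw [hl, key, lap_eq_trace]
  have : J * X.H * X.hess (T s) * (X.H * Jᵀ) * T.mapMatrix Y.G
      = J * (X.H * X.hess (T s) * X.H * Jᵀ * T.mapMatrix Y.G) := by
    simp only [mul_assoc]
  rw [this, Matrix.trace_mul_comm]
  have : X.H * X.hess (T s) * X.H * Jᵀ * T.mapMatrix Y.G * J
      = X.H * X.hess (T s) * (X.H * X.G) := by
    rw [h.metric]
    simp only [mul_assoc]
  rw [this, X.inv_mul, mul_one]

end IsCoordChange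

end CoordMetric

/-! ### Smooth functions on an open set -/

section SmoothRing

open TopologicalSpace Filter Topology

variable {E : Type*} [NormedAddCommGroup E]

open Classical in
/-- Extension by zero. -/
def extendZero (O : Opens E) (f : O → ℝ) (x : E) : ℝ := if h : x ∈ O then f ⟨x, h⟩ else 0

theorem extendZero_of_mem {O : Opens E} (f : O → ℝ) {x : E} (h : x ∈ O) :
    extendZero O f x = f ⟨x, h⟩ := dif_pos h

/-- `O` is open, so derivatives at its points do not see the values outside. -/
theorem extendZero_eventuallyEq {O : Opens E} {f : O → ℝ} {h : E → ℝ} (hfh : ∀ x : O, f x = h x) (x : O) :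
    extendZero O f =ᶠ[𝓝 (x : E)] h := by
  filter_upwards [O.isOpen.mem_nhds x.2] with y hy
  rw [extendZero_of_mem _ (show y ∈ O from hy), hfh]

variable [NormedSpace ℝ E]

/-- The algebra of smooth functions on an open set. -/
def smoothRing (O : Opens E) : Subalgebra ℝ (O → ℝ) where
  carrier := {f | ContDiffOn ℝ ∞ (extendZero O f) O}
  mul_mem' {f g} hf hg := (hf.mul hg).congr fun x hx => by
    simp [extendZero_of_mem _ (show x ∈ O from hx)]
  add_mem' {f g} hf hg := (hf.add hg).congr fun x hx => by
    simp [extendZero_of_mem _ (show x ∈ O from hx)]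
  algebraMap_mem' r := (contDiffOn_const (c := r)).congr fun x hx => by
    simp [extendZero_of_mem _ (show x ∈ O from hx)]

namespace smoothRing

variable {O : Opens E}

instance : CoeFun (smoothRing O) fun _ => O → ℝ := ⟨fun f => f.1⟩

/-- The restriction to `O` of a function that is smooth there. -/
def mk (h : E → ℝ) (hh : ContDiffOn ℝ ∞ h O) : smoothRing O :=
  ⟨fun x => h x, hh.congr fun x hx => by simp [extendZero_of_mem _ (show x ∈ O from hx)]⟩

theorem mk_apply (h : E → ℝ) (hh : ContDiffOn ℝ ∞ h O) (x : O) : mk h hh x = h x := rfl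

@[ext] theorem ext {f g : smoothRing O} (h : ∀ x, f x = g x) : f = g := Subtype.ext (funext h)

/-- Evaluation at a point. -/
def eval (x : O) : smoothRing O →ₐ[ℝ] ℝ :=
  (Pi.evalAlgHom ℝ (fun _ : O => ℝ) x).comp (smoothRing O).val

theorem eval_apply (x : O) (f : smoothRing O) : eval x f = f x := rfl

theorem contDiffAt (f : smoothRing O) (x : O) : ContDiffAt ℝ ∞ (extendZero O f) x :=
  ContDiffOn.contDiffAt f.2 (O.isOpen.mem_nhds x.2)

theorem differentiableAt (f : smoothRing O) (x : O) :
    DifferentiableAt ℝ (extendZero O f) x :=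
  (smoothRing.contDiffAt f x).differentiableAt (by simp)

/-- The derivative in the direction `v`, as a function. -/
def dirDeriv (v : E) (f : smoothRing O) : smoothRing O :=
  mk (fun x => fderiv ℝ (extendZero O f) x v)
    ((ContDiffOn.fderiv_of_isOpen f.2 O.isOpen (by simp)).clm_apply contDiffOn_const)

/-- Any function agreeing with `f` on `O` may be differentiated instead of the extension by zero. -/
theorem dirDeriv_of_eq {h : E → ℝ} {f : smoothRing O} (hf : ∀ x : O, f x = h x) (v : E) (x : O) :
    dirDeriv v f x = fderiv ℝ h x v := by
  change fderiv ℝ (extendZero O f) x v = _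
  rw [(extendZero_eventuallyEq hf x).fderiv_eq]

/-- The derivative in the direction `v`. -/
def D (v : E) : Derivation ℝ (smoothRing O) (smoothRing O) :=
  Derivation.mk'
    { toFun := dirDeriv v
      map_add' := fun f g => by
        ext x
        rw [dirDeriv_of_eq (h := extendZero O f + extendZero O g)
          fun y => by simp [extendZero_of_mem _ y.2]]
        rw [fderiv_add (smoothRing.differentiableAt f x) (smoothRing.differentiableAt g x)]
        rfl
      map_smul' := fun c f => by
        ext x
        rw [dirDeriv_of_eq (h := c • extendZero O f)
          fun y => by simp [extendZero_of_mem _ y.2]]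
        rw [fderiv_const_smul (smoothRing.differentiableAt f x)]
        rfl }
    (fun f g => by
      ext x
      change dirDeriv v (f * g) x = f x * dirDeriv v g x + g x * dirDeriv v f x
      rw [dirDeriv_of_eq (h := extendZero O f * extendZero O g)
          fun y => by simp [extendZero_of_mem _ y.2]]
      rw [fderiv_mul (smoothRing.differentiableAt f x) (smoothRing.differentiableAt g x),
        dirDeriv_of_eq (f := f) (h := extendZero O f) fun y => by simp [extendZero_of_mem _ y.2],
        dirDeriv_of_eq (f := g) (h := extendZero O g) fun y => by simp [extendZero_of_mem _ y.2]]
      simp [extendZero_of_mem _ x.2])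

theorem D_apply (v : E) (f : smoothRing O) (x : O) :
    D v f x = fderiv ℝ (extendZero O f) x v := rfl

theorem D_apply_of_eq {h : E → ℝ} {f : smoothRing O} (hf : ∀ x : O, f x = h x) (v : E) (x : O) :
    D v f x = fderiv ℝ h x v := by
  exact dirDeriv_of_eq hf v x

theorem D_comm (v w : E) (f : smoothRing O) : D v (D w f) = D w (D v f) := by
  ext x
  have key : ∀ v w : E, D v (D w f) x = fderiv ℝ (fderiv ℝ (extendZero O f)) x v w := by
    intro v w
    rw [D_apply_of_eq (h := fun y => fderiv ℝ (extendZero O f) y w) fun y => rfl]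
    have hd : DifferentiableAt ℝ (fderiv ℝ (extendZero O f)) x :=
      ((smoothRing.contDiffAt f x).fderiv_right (m := ∞) (by simp)).differentiableAt (by simp)
    rw [fderiv_clm_apply hd (differentiableAt_const w)]
    simp
  rw [key, key]
  -- Symmetry of the second derivative; over `ℝ` it needs only class `C²`.
  exact ((smoothRing.contDiffAt f x).isSymmSndFDerivAt
    (by rw [minSmoothness_of_isRCLikeNormedField]; exact ENat.LEInfty.out)) v w

/-- The derivative of a pullback. -/
theorem fderiv_comp_eq {E' : Type*} [NormedAddCommGroup E'] [NormedSpace ℝ E'] {ι : E' → E}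
    {L : E' →L[ℝ] E} {y : E'} (hι : HasFDerivAt ι L y) (hy : ι y ∈ O) {f : smoothRing O}
    {h : E' → ℝ} (hh : ∀ᶠ z in 𝓝 y, ∀ hz : ι z ∈ O, h z = f ⟨ι z, hz⟩) (w : E') :
    fderiv ℝ h y w = D (L w) f ⟨ι y, hy⟩ := by
  have he : h =ᶠ[𝓝 y] extendZero O f ∘ ι := by
    filter_upwards [hh, hι.continuousAt.preimage_mem_nhds (O.isOpen.mem_nhds hy)] with z hz hzO
    rw [hz hzO, Function.comp, extendZero_of_mem _ (show ι z ∈ O from hzO)]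
  rw [he.fderiv_eq, D_apply]
  have := (smoothRing.differentiableAt f ⟨ι y, hy⟩).hasFDerivAt.comp y hι
  rw [this.fderiv]
  rfl

theorem isUnit {f : smoothRing O} (hf : ∀ x, f x ≠ 0) : IsUnit f := by
  have hg : ContDiffOn ℝ ∞ (fun x => (extendZero O f x)⁻¹) O :=
    ContDiffOn.inv f.2 fun x hx => by
      rw [extendZero_of_mem _ (show x ∈ O from hx)]
      exact hf _
  refine IsUnit.of_mul_eq_one (mk _ hg) ?_
  ext x
  change f x * (extendZero O f x)⁻¹ = 1
  rw [extendZero_of_mem _ x.2]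
  exact mul_inv_cancel₀ (hf x)

/-- Pullback along a smooth map. -/
def pullback {E' : Type*} [NormedAddCommGroup E'] [NormedSpace ℝ E'] {O' : Opens E'}
    (τ : E' → E) (hτ : ContDiffOn ℝ ∞ τ O') (hm : ∀ x ∈ O', τ x ∈ O) :
    smoothRing O →+* smoothRing O' where
  toFun f := mk (fun x => extendZero O f (τ x)) (ContDiffOn.comp f.2 hτ hm)
  map_one' := by
    ext x
    simp [mk_apply, extendZero_of_mem _ (hm x x.2)]
  map_mul' f g := by
    ext x
    simp [mk_apply, extendZero_of_mem _ (hm x x.2)]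
  map_zero' := by
    ext x
    simp [mk_apply, extendZero_of_mem _ (hm x x.2)]
  map_add' f g := by
    ext x
    simp [mk_apply, extendZero_of_mem _ (hm x x.2)]

theorem pullback_apply {E' : Type*} [NormedAddCommGroup E'] [NormedSpace ℝ E'] {O' : Opens E'}
    (τ : E' → E) (hτ : ContDiffOn ℝ ∞ τ O') (hm : ∀ x ∈ O', τ x ∈ O) (f : smoothRing O) (x : O') :
    pullback τ hτ hm f x = f ⟨τ x, hm x x.2⟩ := by
  change extendZero O f (τ x) = _
  rw [extendZero_of_mem _ (hm x x.2)]

end smoothRing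

end SmoothRing

/-! ### Charts -/

section Charts

open TopologicalSpace Filter Topology Bundle

variable {n : ℕ} {M : Type*} [TopologicalSpace M] [ChartedSpace (EuclideanSpace ℝ (Fin n)) M]
  [IsManifold (𝓡 n) ∞ M] (g : SmoothMetric n M)

omit [IsManifold (𝓡 n) ∞ M] in
theorem isOpen_target (p : M) : IsOpen (extChartAt (𝓡 n) p).target := isOpen_extChartAt_target p

theorem mdifferentiableAt_chart_symm {p : M} {y : EuclideanSpace ℝ (Fin n)}
    (hy : y ∈ (extChartAt (𝓡 n) p).target) :
    MDifferentiableAt 𝓘(ℝ, EuclideanSpace ℝ (Fin n)) (𝓡 n) (extChartAt (𝓡 n) p).symm y :=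
  ((contMDiffOn_extChartAt_symm (n := ∞) p).contMDiffAt
    ((isOpen_extChartAt_target p).mem_nhds hy)).mdifferentiableAt (by simp)

/-- The coordinate field is the tangent map of the inverse chart applied to a constant section. -/
theorem contMDiffOn_coordVec (p : M) (i : Fin n) :
    ContMDiffOn 𝓘(ℝ, EuclideanSpace ℝ (Fin n)) ((𝓡 n).prod 𝓘(ℝ, EuclideanSpace ℝ (Fin n))) ∞
      (fun y => TotalSpace.mk' (EuclideanSpace ℝ (Fin n))
        (E := fun x : M => TangentSpace (𝓡 n) x) ((extChartAt (𝓡 n) p).symm y) (coordVec p i y))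
      (extChartAt (𝓡 n) p).target := by
  have hopen := isOpen_extChartAt_target (I := 𝓡 n) p
  have h1 := (contMDiffOn_extChartAt_symm (I := 𝓡 n) (n := ∞) p).contMDiffOn_tangentMapWithin
    (m := ∞) (by simp) hopen.uniqueMDiffOn
  have h2 : ContMDiff 𝓘(ℝ, EuclideanSpace ℝ (Fin n)) 𝓘(ℝ, EuclideanSpace ℝ (Fin n)).tangent ∞
      (fun y : EuclideanSpace ℝ (Fin n) => (⟨y, EuclideanSpace.single i (1 : ℝ)⟩ :
        TangentBundle 𝓘(ℝ, EuclideanSpace ℝ (Fin n)) (EuclideanSpace ℝ (Fin n)))) := by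
    apply contMDiff_vectorSpace_iff_contDiff.2
    exact contDiff_const
  refine (h1.comp h2.contMDiffOn (fun y hy => hy)).congr fun y hy => ?_
  simp only [Function.comp, tangentMapWithin, coordVec]
  rw [mfderivWithin_of_isOpen hopen hy]

/-- The metric is a smooth section of bilinear forms, evaluated on two smooth fields along the
inverse chart; the values lie in a trivial line bundle. -/
theorem contDiffOn_metricMatrix (p : M) (i j : Fin n) :
    ContDiffOn ℝ ∞ (fun y => metricMatrix g p y i j) (extChartAt (𝓡 n) p).target := by
  rw [← contMDiffOn_iff_contDiffOn]
  intro y hy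
  have h : ContMDiffWithinAt 𝓘(ℝ, EuclideanSpace ℝ (Fin n)) ((𝓡 n).prod 𝓘(ℝ)) ∞
      (fun m ↦ TotalSpace.mk' ℝ (E := Bundle.Trivial M ℝ) ((extChartAt (𝓡 n) p).symm m)
        (metricMatrix g p m i j)) (extChartAt (𝓡 n) p).target y := by
    apply ContMDiffWithinAt.clm_bundle_apply₂ (𝕜 := ℝ) (F₁ := EuclideanSpace ℝ (Fin n))
      (F₂ := EuclideanSpace ℝ (Fin n)) (F₃ := ℝ) (E₁ := fun x : M => TangentSpace (𝓡 n) x)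
      (E₂ := fun x : M => TangentSpace (𝓡 n) x) (E₃ := Bundle.Trivial M ℝ)
      (b := fun m => (extChartAt (𝓡 n) p).symm m)
      (ψ := fun m => g.inner ((extChartAt (𝓡 n) p).symm m))
      (v := fun m => coordVec p i m) (w := fun m => coordVec p j m)
    · exact ContMDiffAt.comp_contMDiffWithinAt y g.contMDiff.contMDiffAt
        (contMDiffOn_extChartAt_symm (n := ∞) p y hy)
    · exact contMDiffOn_coordVec p i y hy
    · exact contMDiffOn_coordVec p j y hy
  simp only [contMDiffWithinAt_totalSpace] at h
  exact h.2

theorem metricMatrix_transpose (p : M) (y : EuclideanSpace ℝ (Fin n)) :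
    (metricMatrix g p y)ᵀ = metricMatrix g p y := by
  ext i j
  simp only [metricMatrix, Matrix.transpose_apply, Matrix.of_apply]
  exact g.symm _ _ _

/-- The derivative of the inverse chart, read in the model space. -/
def chartDeriv (p : M) (y : EuclideanSpace ℝ (Fin n)) :
    EuclideanSpace ℝ (Fin n) →L[ℝ] EuclideanSpace ℝ (Fin n) :=
  mfderiv 𝓘(ℝ, EuclideanSpace ℝ (Fin n)) (𝓡 n) (extChartAt (𝓡 n) p).symm y

/-- The metric, read in the model space. -/
def innerAt (x : M) :
    EuclideanSpace ℝ (Fin n) →L[ℝ] EuclideanSpace ℝ (Fin n) →L[ℝ] ℝ :=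
  g.inner x

theorem metricMatrix_apply (p : M) (y : EuclideanSpace ℝ (Fin n)) (i j : Fin n) :
    metricMatrix g p y i j = innerAt g ((extChartAt (𝓡 n) p).symm y)
      (chartDeriv p y (EuclideanSpace.single i 1))
      (chartDeriv p y (EuclideanSpace.single j 1)) := rfl

theorem innerAt_self_ne_zero (x : M) {v : EuclideanSpace ℝ (Fin n)} (hv : v ≠ 0) :
    innerAt g x v v ≠ 0 := (g.pos x v hv).ne'

theorem chartDeriv_injective {p : M} {y : EuclideanSpace ℝ (Fin n)}
    (hy : y ∈ (extChartAt (𝓡 n) p).target) : Function.Injective (chartDeriv p y) := by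
  have h := isInvertible_mfderivWithin_extChartAt_symm hy
  rw [ModelWithCorners.range_eq_univ, mfderivWithin_univ] at h
  exact h.injective

theorem sum_single (v : EuclideanSpace ℝ (Fin n)) :
    ∑ i, v i • EuclideanSpace.single i (1 : ℝ) = v := by
  ext j
  simp [Pi.single_apply]

/-- A kernel vector of the matrix pushes forward to a tangent vector of length zero; definiteness
and injectivity of the derivative of the inverse chart make it zero. -/
theorem metricMatrix_det_ne_zero {p : M} {y : EuclideanSpace ℝ (Fin n)}
    (hy : y ∈ (extChartAt (𝓡 n) p).target) : (metricMatrix g p y).det ≠ 0 := by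
  intro hdet
  obtain ⟨v, hv, hGv⟩ := Matrix.exists_mulVec_eq_zero_iff.2 hdet
  set v' : EuclideanSpace ℝ (Fin n) := WithLp.toLp 2 v
  set w := chartDeriv p y v' with hw
  have h0 : innerAt g ((extChartAt (𝓡 n) p).symm y) w w = 0 := by
    have : innerAt g ((extChartAt (𝓡 n) p).symm y) w w = v ⬝ᵥ (metricMatrix g p y *ᵥ v) := by
      rw [hw, ← sum_single v']
      simp only [map_sum, map_smul, _root_.sum_apply, _root_.smul_apply, dotProduct, mulVec,
        metricMatrix_apply, mul_sum, smul_eq_mul, v']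
      rw [sum_comm]
      exact sum_congr rfl fun i _ => sum_congr rfl fun j _ => by ring
    rw [this, hGv, dotProduct_zero]
  have hw0 : w = 0 := by
    by_contra h
    exact innerAt_self_ne_zero g _ h h0
  have hz : v' = 0 := chartDeriv_injective hy (hw0.trans (map_zero _).symm)
  apply hv
  ext i
  exact congrArg (fun u : EuclideanSpace ℝ (Fin n) => u i) hz

/-- The transition map between two charts. -/
def transition (p q : M) (y : EuclideanSpace ℝ (Fin n)) : EuclideanSpace ℝ (Fin n) :=
  extChartAt (𝓡 n) q ((extChartAt (𝓡 n) p).symm y)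

/-- The domain of the transition map. -/
def overlap (p q : M) : Opens (EuclideanSpace ℝ (Fin n)) where
  carrier := (extChartAt (𝓡 n) p).target ∩
    (extChartAt (𝓡 n) p).symm ⁻¹' (extChartAt (𝓡 n) q).source
  is_open' := (continuousOn_extChartAt_symm p).isOpen_inter_preimage
    (isOpen_extChartAt_target p) (isOpen_extChartAt_source q)

theorem contDiffOn_transition (p q : M) :
    ContDiffOn ℝ ∞ (transition (n := n) p q) (overlap (n := n) p q) := by
  rw [← contMDiffOn_iff_contDiffOn]
  exact (contMDiffOn_extChartAt (I := 𝓡 n) (n := ∞) (x := q)).comp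
    ((contMDiffOn_extChartAt_symm (n := ∞) p).mono Set.inter_subset_left) fun y hy => by simpa using hy.2

omit [IsManifold (𝓡 n) ∞ M] in
theorem transition_mem_target {p q : M} {y : EuclideanSpace ℝ (Fin n)} (hy : y ∈ overlap p q) :
    transition p q y ∈ (extChartAt (𝓡 n) q).target :=
  (extChartAt (𝓡 n) q).map_source hy.2

omit [IsManifold (𝓡 n) ∞ M] in
theorem symm_transition {p q : M} {y : EuclideanSpace ℝ (Fin n)} (hy : y ∈ overlap p q) :
    (extChartAt (𝓡 n) q).symm (transition p q y) = (extChartAt (𝓡 n) p).symm y :=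
  (extChartAt (𝓡 n) q).left_inv hy.2

theorem differentiableAt_transition {p q : M} {y : EuclideanSpace ℝ (Fin n)}
    (hy : y ∈ overlap p q) : DifferentiableAt ℝ (transition p q) y :=
  ((contDiffOn_transition p q).contDiffAt ((overlap p q).isOpen.mem_nhds hy)).differentiableAt
    (by simp)

/-- Near `y` the inverse chart of `p` is that of `q` after the transition map; this is the chain
rule. -/
theorem chartDeriv_eq_comp {p q : M} {y : EuclideanSpace ℝ (Fin n)} (hy : y ∈ overlap p q) :
    chartDeriv p y = (chartDeriv q (transition p q y)).comp (fderiv ℝ (transition p q) y) := by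
  have he : (extChartAt (𝓡 n) p).symm =ᶠ[𝓝 y] (extChartAt (𝓡 n) q).symm ∘ transition p q := by
    filter_upwards [(overlap p q).isOpen.mem_nhds hy] with z hz
    exact (symm_transition hz).symm
  have h1 := he.mfderiv_eq (I := 𝓘(ℝ, EuclideanSpace ℝ (Fin n))) (I' := 𝓡 n)
  have h2 := mfderiv_comp y (mdifferentiableAt_chart_symm (transition_mem_target hy))
    (differentiableAt_transition hy).mdifferentiableAt
  rw [mfderiv_eq_fderiv] at h2
  exact h1.trans h2

/-- The Jacobian matrix of the transition map. -/
def jacobian (p q : M) (y : EuclideanSpace ℝ (Fin n)) : Matrix (Fin n) (Fin n) ℝ :=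
  Matrix.of fun a i => pd i (fun z => transition p q z a) y

theorem fderiv_transition_apply {p q : M} {y : EuclideanSpace ℝ (Fin n)} (hy : y ∈ overlap p q)
    (a i : Fin n) :
    fderiv ℝ (transition p q) y (EuclideanSpace.single i 1) a = jacobian p q y a i := by
  have h := (differentiableAt_transition hy).hasFDerivAt
  have h2 := (EuclideanSpace.proj (𝕜 := ℝ) a).hasFDerivAt.comp y h
  simp only [jacobian, pd, Matrix.of_apply]
  erw [h2.fderiv]
  rfl

theorem metricMatrix_transition {p q : M} {y : EuclideanSpace ℝ (Fin n)} (hy : y ∈ overlap p q) :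
    metricMatrix g p y
      = (jacobian p q y)ᵀ * metricMatrix g q (transition p q y) * jacobian p q y := by
  ext i j
  rw [metricMatrix_apply, chartDeriv_eq_comp hy, ← symm_transition hy]
  simp only [ContinuousLinearMap.comp_apply]
  rw [← sum_single (fderiv ℝ (transition p q) y (EuclideanSpace.single i 1)),
    ← sum_single (fderiv ℝ (transition p q) y (EuclideanSpace.single j 1))]
  simp only [map_sum, map_smul, _root_.sum_apply, _root_.smul_apply, Matrix.mul_apply,
    metricMatrix_apply, sum_mul, smul_eq_mul, fderiv_transition_apply hy, Matrix.transpose_apply]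
  refine sum_congr rfl fun a _ => ?_
  rw [mul_sum]
  exact sum_congr rfl fun b _ => by ring

end Charts

/-! ### The coordinate metric of a chart, over functions on space-time -/

section ChartMetric

open TopologicalSpace Filter Topology smoothRing

variable {n : ℕ} {M : Type*} [TopologicalSpace M] [ChartedSpace (EuclideanSpace ℝ (Fin n)) M]
  [IsManifold (𝓡 n) ∞ M] (g : SmoothMetric n M)

/-- The coordinate vector `e_i` of space-time. -/
def spaceVec (i : Fin n) : EuclideanSpace ℝ (Fin n) × ℝ := (EuclideanSpace.single i 1, 0)

/-- The matrix of the metric over the ring of smooth functions. -/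
def ringMetric (p : M) {O : Opens (EuclideanSpace ℝ (Fin n) × ℝ)}
    (hO : ∀ x ∈ O, x.1 ∈ (extChartAt (𝓡 n) p).target) :
    Matrix (Fin n) (Fin n) (smoothRing O) :=
  Matrix.of fun i j => smoothRing.mk (fun x => metricMatrix g p x.1 i j)
    ((contDiffOn_metricMatrix g p i j).comp contDiffOn_fst hO)

variable {p : M} {O : Opens (EuclideanSpace ℝ (Fin n) × ℝ)}
  (hO : ∀ x ∈ O, x.1 ∈ (extChartAt (𝓡 n) p).target)

theorem eval_ringMetric (x : O) :
    (eval x).mapMatrix (ringMetric g p hO) = metricMatrix g p (x : _ × ℝ).1 := rfl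

theorem isUnit_det_ringMetric : IsUnit (ringMetric g p hO).det := by
  apply smoothRing.isUnit
  intro x
  rw [← eval_apply, AlgHom.map_det, eval_ringMetric]
  exact metricMatrix_det_ne_zero g (hO x x.2)

/-- The metric in the chart around `p`, over the smooth functions on an open set of space-time. -/
def chartMetric : CoordMetric n (smoothRing O) where
  d i := D (spaceVec i)
  comm i j r := D_comm _ _ r
  G := ringMetric g p hO
  H := (ringMetric g p hO)⁻¹
  symm := by
    ext i j x
    exact congrFun (congrFun (metricMatrix_transpose g p (x : _ × ℝ).1) i) j
  inv_mul := Matrix.nonsing_inv_mul _ (isUnit_det_ringMetric g hO)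

theorem chartMetric_G (x : O) (i j : Fin n) :
    (chartMetric g hO).G i j x = metricMatrix g p (x : _ × ℝ).1 i j := rfl

/-- Evaluation is a ring homomorphism and an inverse matrix is unique. -/
theorem chartMetric_H (x : O) (i j : Fin n) :
    (chartMetric g hO).H i j x = metricInv g p (x : _ × ℝ).1 i j := by
  have h : (eval x).mapMatrix (chartMetric g hO).H * metricMatrix g p (x : _ × ℝ).1 = 1 := by
    rw [← eval_ringMetric g hO x, ← map_mul]
    erw [(chartMetric g hO).inv_mul]
    exact map_one _
  rw [metricInv, Matrix.inv_eq_left_inv h]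
  rfl

/-- Chain rule along the slice `y ↦ (y, t)`. Agreement on the whole slice is assumed, so the lemma
can be iterated for second derivatives and for derivatives of `Γ`. -/
theorem pd_eq {h : EuclideanSpace ℝ (Fin n) → ℝ} {r : smoothRing O} {t : ℝ}
    (hr : ∀ y (hy : (y, t) ∈ O), h y = r ⟨(y, t), hy⟩) (i : Fin n)
    (y : EuclideanSpace ℝ (Fin n)) (hy : (y, t) ∈ O) :
    pd i h y = (chartMetric g hO).d i r ⟨(y, t), hy⟩ := by
  have := fderiv_comp_eq (hasFDerivAt_prodMk_left y t) hy (f := r) (h := h)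
    (Eventually.of_forall hr) (EuclideanSpace.single i 1)
  exact this

omit [IsManifold (𝓡 n) ∞ M] in
theorem deriv_eq {h : ℝ → ℝ} {r : smoothRing O} {y : EuclideanSpace ℝ (Fin n)}
    (hr : ∀ s (hs : (y, s) ∈ O), h s = r ⟨(y, s), hs⟩) (t : ℝ) (ht : (y, t) ∈ O) :
    deriv h t = D (0, 1) r ⟨(y, t), ht⟩ :=
  fderiv_comp_eq (hasFDerivAt_prodMk_right y t) ht (f := r) (h := h)
    (Eventually.of_forall hr) (1 : ℝ)

/-! ### Evaluation -/

theorem ring_sum_apply {ι : Type*} (s : Finset ι) (F : ι → smoothRing O) (x : O) :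
    (∑ i ∈ s, F i : smoothRing O) x = ∑ i ∈ s, F i x := by
  simp only [← eval_apply, map_sum]

theorem ring_mul_apply (a b : smoothRing O) (x : O) : (a * b : smoothRing O) x = a x * b x := rfl
theorem ring_add_apply (a b : smoothRing O) (x : O) : (a + b : smoothRing O) x = a x + b x := rfl
theorem ring_sub_apply (a b : smoothRing O) (x : O) : (a - b : smoothRing O) x = a x - b x := rfl
theorem ring_neg_apply (a : smoothRing O) (x : O) : (-a : smoothRing O) x = -a x := rfl
theorem ring_algebraMap_apply (a : ℝ) (x : O) :
    (algebraMap ℝ (smoothRing O) a) x = a := rfl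

theorem christoffel_eq (m i j : Fin n) (t : ℝ) (y : EuclideanSpace ℝ (Fin n))
    (hy : (y, t) ∈ O) :
    christoffel g p m i j y = (chartMetric g hO).Γ m i j ⟨(y, t), hy⟩ := by
  have hd : ∀ i j l, pd i (fun z => metricMatrix g p z j l) y
      = (chartMetric g hO).d i ((chartMetric g hO).G j l) ⟨(y, t), hy⟩ := fun i j l =>
    pd_eq g hO (fun z hz => rfl) i y hy
  simp only [christoffel, CoordMetric.Γ, hd, ring_mul_apply, ring_sum_apply, ring_sub_apply,
    ring_add_apply, ring_algebraMap_apply, chartMetric_H]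

theorem coordRicci_eq (i j : Fin n) (t : ℝ) (y : EuclideanSpace ℝ (Fin n)) (hy : (y, t) ∈ O) :
    coordRicci g p i j y = (chartMetric g hO).ric i j ⟨(y, t), hy⟩ := by
  have hd : ∀ k m i j, pd k (christoffel g p m i j) y
      = (chartMetric g hO).d k ((chartMetric g hO).Γ m i j) ⟨(y, t), hy⟩ := fun k m i j =>
    pd_eq g hO (fun z hz => christoffel_eq g hO m i j t z hz) k y hy
  simp only [coordRicci, CoordMetric.ric, hd, christoffel_eq g hO _ _ _ t y hy, ring_mul_apply,
    ring_sum_apply, ring_sub_apply, ring_add_apply]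

section Function

variable {h : M → ℝ} {r : smoothRing O} {t : ℝ}
  (hr : ∀ y (hy : (y, t) ∈ O), inChart p h y = r ⟨(y, t), hy⟩)

include hr

theorem coordHess_eq (i j : Fin n) (y : EuclideanSpace ℝ (Fin n)) (hy : (y, t) ∈ O) :
    coordHess g p h i j y = (chartMetric g hO).hess r i j ⟨(y, t), hy⟩ := by
  have h1 : ∀ i z (hz : (z, t) ∈ O), pd i (inChart p h) z
      = (chartMetric g hO).d i r ⟨(z, t), hz⟩ := fun i => pd_eq g hO hr i
  have h2 : pd i (pd j (inChart p h)) y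
      = (chartMetric g hO).d i ((chartMetric g hO).d j r) ⟨(y, t), hy⟩ :=
    pd_eq g hO (h1 j) i y hy
  simp only [coordHess, CoordMetric.hess, Matrix.of_apply, h2, h1 _ y hy,
    christoffel_eq g hO _ _ _ t y hy, ring_mul_apply, ring_sum_apply, ring_sub_apply]

end Function

end ChartMetric

/-! ### Tensor components at the centre of a chart -/

section Centre

open TopologicalSpace Filter Topology smoothRing

variable {n : ℕ} {M : Type*} [TopologicalSpace M] [ChartedSpace (EuclideanSpace ℝ (Fin n)) M]
  [IsManifold (𝓡 n) ∞ M] (g : SmoothMetric n M)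
  {x : M} {O : Opens (EuclideanSpace ℝ (Fin n) × ℝ)}
  (hO : ∀ q ∈ O, q.1 ∈ (extChartAt (𝓡 n) x).target) {t : ℝ}
  (hx : (extChartAt (𝓡 n) x x, t) ∈ O)

theorem gLow_eq (i j : Fin n) : gLow g x i j = (chartMetric g hO).G i j ⟨_, hx⟩ := rfl

theorem gUp_eq (i j : Fin n) : gUp g x i j = (chartMetric g hO).H i j ⟨_, hx⟩ :=
  (chartMetric_H g hO ⟨_, hx⟩ i j).symm

theorem ricci_eq (i j : Fin n) : ricci g x i j = (chartMetric g hO).ric i j ⟨_, hx⟩ :=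
  coordRicci_eq g hO i j t _ hx

theorem tensorNormSq_eq {A : Fin n → Fin n → ℝ} {B : Matrix (Fin n) (Fin n) (smoothRing O)}
    (hAB : ∀ i j, A i j = B i j ⟨_, hx⟩) :
    tensorNormSq g x A = (chartMetric g hO).normSq B ⟨_, hx⟩ := by
  simp only [tensorNormSq, CoordMetric.normSq, ring_sum_apply, ring_mul_apply, hAB,
    gUp_eq g hO hx]

variable {h : M → ℝ} {r : smoothRing O}
  (hr : ∀ y (hy : (y, t) ∈ O), inChart x h y = r ⟨(y, t), hy⟩)

include hr

theorem hess_eq (i j : Fin n) : hess g h x i j = (chartMetric g hO).hess r i j ⟨_, hx⟩ :=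
  coordHess_eq g hO hr i j _ hx

theorem dLow_eq (i : Fin n) : dLow h x i = (chartMetric g hO).d i r ⟨_, hx⟩ :=
  pd_eq g hO hr i _ hx

theorem gradUp_eq (i : Fin n) : gradUp g h x i = (chartMetric g hO).grad r i ⟨_, hx⟩ := by
  simp only [gradUp, CoordMetric.grad, ring_sum_apply, ring_mul_apply, gUp_eq g hO hx,
    dLow_eq g hO hx hr]

theorem laplacian_eq_centre : laplacian g h x = (chartMetric g hO).lap r ⟨_, hx⟩ := by
  simp only [laplacian, CoordMetric.lap, ring_sum_apply, ring_mul_apply, gUp_eq g hO hx,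
    hess_eq g hO hx hr]

theorem gradNormSq_eq_centre : gradNormSq g h x = (chartMetric g hO).pairing r r ⟨_, hx⟩ := by
  rw [CoordMetric.pairing_eq_G]
  simp only [gradNormSq, ring_sum_apply, ring_mul_apply, gLow_eq g hO hx,
    gradUp_eq g hO hx hr]

theorem ricciShiftGrad_eq (k : ℝ) :
    ricciShiftGrad g k h x = (∑ i, ∑ j, ((chartMetric g hO).ric i j
      + algebraMap ℝ (smoothRing O) k * (chartMetric g hO).G i j) * (chartMetric g hO).grad r i
        * (chartMetric g hO).grad r j : smoothRing O) ⟨_, hx⟩ := by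
  simp only [ricciShiftGrad, ring_sum_apply, ring_mul_apply, ring_add_apply,
    ring_algebraMap_apply, gLow_eq g hO hx, ricci_eq g hO hx, gradUp_eq g hO hx hr]

end Centre

/-! ### Independence of the chart -/

section Invariance

open TopologicalSpace Filter Topology smoothRing

variable {n : ℕ} {M : Type*} [TopologicalSpace M] [ChartedSpace (EuclideanSpace ℝ (Fin n)) M]
  [IsManifold (𝓡 n) ∞ M] (g : SmoothMetric n M)

/-- The coordinate functions. -/
def coord {O : Opens (EuclideanSpace ℝ (Fin n) × ℝ)} (a : Fin n) : smoothRing O :=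
  smoothRing.mk (fun x => x.1 a)
    ((EuclideanSpace.proj (𝕜 := ℝ) a).contDiff.comp contDiff_fst).contDiffOn

theorem D_coord {O : Opens (EuclideanSpace ℝ (Fin n) × ℝ)} (i a : Fin n) :
    D (spaceVec i) (coord (O := O) a) = if i = a then 1 else 0 := by
  ext x
  have h : HasFDerivAt (fun x : EuclideanSpace ℝ (Fin n) × ℝ => x.1 a)
      ((EuclideanSpace.proj (𝕜 := ℝ) a).comp (ContinuousLinearMap.fst ℝ _ ℝ)) x.1 :=
    ((EuclideanSpace.proj (𝕜 := ℝ) a).comp (ContinuousLinearMap.fst ℝ _ ℝ)).hasFDerivAt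
  rw [D_apply_of_eq (f := coord a) (h := fun x => x.1 a) (fun _ => rfl), h.fderiv]
  by_cases hia : i = a
  · subst hia
    simp [spaceVec]
  · simp [spaceVec, hia, Ne.symm hia]

/-- The space-time domain of the chart around `p`. -/
def chartDomain (p : M) (J : Opens ℝ) : Opens (EuclideanSpace ℝ (Fin n) × ℝ) :=
  ⟨(extChartAt (𝓡 n) p).target ×ˢ J, (isOpen_target p).prod J.isOpen⟩

omit [IsManifold (𝓡 n) ∞ M] in
theorem mem_target_of_mem_chartDomain {p : M} {J : Opens ℝ} :
    ∀ x ∈ chartDomain (n := n) p J, x.1 ∈ (extChartAt (𝓡 n) p).target := fun _ hx => hx.1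

/-- The space-time domain of the transition map between two charts. -/
def overlapDomain (p q : M) (J : Opens ℝ) : Opens (EuclideanSpace ℝ (Fin n) × ℝ) :=
  ⟨((overlap p q : Opens (EuclideanSpace ℝ (Fin n))) : Set _) ×ˢ J,
    (overlap p q).isOpen.prod J.isOpen⟩

omit [IsManifold (𝓡 n) ∞ M] in
theorem mem_target_of_mem_overlapDomain {p q : M} {J : Opens ℝ} :
    ∀ x ∈ overlapDomain (n := n) p q J, x.1 ∈ (extChartAt (𝓡 n) p).target := fun _ hx => hx.1.1

/-- The change of charts, as a map of rings of functions. -/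
def changeChart (p q : M) (J : Opens ℝ) :
    smoothRing (chartDomain (n := n) q J) →+* smoothRing (overlapDomain (n := n) p q J) :=
  pullback (fun x => (transition p q x.1, x.2))
    (((contDiffOn_transition p q).comp contDiffOn_fst fun _ hx => hx.1).prodMk contDiffOn_snd)
    fun _ hx => ⟨transition_mem_target hx.1, hx.2⟩

theorem changeChart_apply (p q : M) (J : Opens ℝ) (r : smoothRing (chartDomain (n := n) q J))
    (y : EuclideanSpace ℝ (Fin n)) (t : ℝ) (hy : (y, t) ∈ overlapDomain (n := n) p q J) :
    changeChart p q J r ⟨(y, t), hy⟩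
      = r ⟨(transition p q y, t), transition_mem_target hy.1, hy.2⟩ :=
  pullback_apply _ _ _ _ _

/-- The Jacobian matrix over the ring of smooth functions. -/
def ringJacobian (p q : M) (J : Opens ℝ) :
    Matrix (Fin n) (Fin n) (smoothRing (overlapDomain (n := n) p q J)) :=
  Matrix.of fun a i => D (spaceVec i) (changeChart p q J (coord a))

theorem ringJacobian_apply (g : SmoothMetric n M) (p q : M) (J : Opens ℝ) (a i : Fin n)
    (y : EuclideanSpace ℝ (Fin n)) (t : ℝ) (hy : (y, t) ∈ overlapDomain (n := n) p q J) :
    ringJacobian p q J a i ⟨(y, t), hy⟩ = jacobian p q y a i :=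
  (pd_eq g mem_target_of_mem_overlapDomain
    (fun z hz => (changeChart_apply p q J (coord a) z t hz).symm) i y hy).symm

-- Chain rule for `(y, t) ↦ (transition y, t)`: a spatial vector is sent to a spatial vector, with
-- the Jacobian entries as coefficients.
include g in
theorem D_changeChart (p q : M) (J : Opens ℝ) (r : smoothRing (chartDomain (n := n) q J))
    (i : Fin n) :
    D (spaceVec i) (changeChart p q J r)
      = ∑ a, ringJacobian p q J a i * changeChart p q J (D (spaceVec a) r) := by
  ext ⟨⟨y, t⟩, hy⟩
  have hτ : HasFDerivAt (fun x : EuclideanSpace ℝ (Fin n) × ℝ => (transition p q x.1, x.2))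
      ((fderiv ℝ (transition p q) y).prodMap (ContinuousLinearMap.id ℝ ℝ)) (y, t) :=
    HasFDerivAt.prodMap (y, t) (differentiableAt_transition hy.1).hasFDerivAt (hasFDerivAt_id t)
  have hm : (transition p q y, t) ∈ chartDomain (n := n) q J :=
    ⟨transition_mem_target hy.1, hy.2⟩
  rw [D_apply, fderiv_comp_eq hτ hm (f := r)]
  · have hv : ((fderiv ℝ (transition p q) y).prodMap (ContinuousLinearMap.id ℝ ℝ)) (spaceVec i)
        = ∑ a, jacobian p q y a i • spaceVec a := by
      have := sum_single (fderiv ℝ (transition p q) y (EuclideanSpace.single i 1))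
      simp only [fderiv_transition_apply hy.1] at this
      refine Prod.ext ?_ ?_
      · simp only [spaceVec, Prod.fst_sum, Prod.smul_fst]
        exact this.symm
      · simp [spaceVec, Prod.snd_sum]
    rw [hv]
    simp only [ring_sum_apply, ring_mul_apply, ringJacobian_apply g, changeChart_apply, D_apply,
      map_sum, map_smul, smul_eq_mul]
  · filter_upwards [(overlapDomain (n := n) p q J).isOpen.mem_nhds hy] with z hz _
    rw [extendZero_of_mem _ hz]
    exact changeChart_apply p q J r z.1 z.2 hz

theorem isCoordChange (p q : M) (J : Opens ℝ) :
    CoordMetric.IsCoordChange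
      (chartMetric g (p := p) (O := overlapDomain (n := n) p q J) mem_target_of_mem_overlapDomain)
      (chartMetric g (p := q) (O := chartDomain (n := n) q J) mem_target_of_mem_chartDomain)
      (changeChart p q J) (ringJacobian p q J) where
  chain i r := D_changeChart g p q J r i
  metric := by
    ext i j ⟨⟨y, t⟩, hy⟩
    simp only [Matrix.mul_apply, ring_sum_apply, ring_mul_apply, Matrix.transpose_apply,
      ringJacobian_apply g, chartMetric_G, RingHom.mapMatrix_apply, Matrix.map_apply,
      changeChart_apply]
    exact congrFun (congrFun (metricMatrix_transition g hy.1) i) j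

section Pointwise

variable {p : M} {J : Opens ℝ} {t : ℝ} {h : M → ℝ} {r : smoothRing (chartDomain (n := n) p J)}
  (hr : ∀ y (hy : (y, t) ∈ chartDomain (n := n) p J),
    h ((extChartAt (𝓡 n) p).symm y) = r ⟨(y, t), hy⟩)
  {y : EuclideanSpace ℝ (Fin n)} (hy : (y, t) ∈ chartDomain (n := n) p J)

omit [IsManifold (𝓡 n) ∞ M] in
theorem centre_mem_overlapDomain {z : M} (hz : z ∈ (extChartAt (𝓡 n) p).source) (ht : t ∈ J) :
    (extChartAt (𝓡 n) z z, t) ∈ overlapDomain (n := n) z p J := by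
  refine ⟨⟨mem_extChartAt_target z, ?_⟩, ht⟩
  simpa [Set.mem_preimage, extChartAt_to_inv z] using hz

omit [IsManifold (𝓡 n) ∞ M] in
theorem transition_centre (hy : y ∈ (extChartAt (𝓡 n) p).target) :
    transition ((extChartAt (𝓡 n) p).symm y) p
      (extChartAt (𝓡 n) ((extChartAt (𝓡 n) p).symm y) ((extChartAt (𝓡 n) p).symm y)) = y := by
  rw [transition, extChartAt_to_inv, (extChartAt (𝓡 n) p).right_inv hy]

include hr

theorem inChart_eq_changeChart (z : M) (w : EuclideanSpace ℝ (Fin n))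
    (hw : (w, t) ∈ overlapDomain (n := n) z p J) :
    inChart z h w = changeChart z p J r ⟨(w, t), hw⟩ := by
  rw [changeChart_apply]
  refine Eq.trans ?_ (hr (transition z p w) ⟨transition_mem_target hw.1, hw.2⟩)
  rw [symm_transition hw.1, inChart]

/-- The Laplacian may be computed in any chart. -/
theorem laplacian_eq :
    laplacian g h ((extChartAt (𝓡 n) p).symm y)
      = (chartMetric g mem_target_of_mem_chartDomain).lap r ⟨(y, t), hy⟩ := by
  have hz := (extChartAt (𝓡 n) p).map_target hy.1
  have hm := centre_mem_overlapDomain hz hy.2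
  -- Compute in the chart preferred at the point, as the definition does, then carry the result to
  -- the chart of `p`; the transition map sends the centre to `y`.
  rw [laplacian_eq_centre g mem_target_of_mem_overlapDomain hm
    (inChart_eq_changeChart hr _), ← (isCoordChange g _ p J).map_lap (fun i a => D_coord i a),
    changeChart_apply]
  simp only [transition_centre hy.1]

/-- The length of the gradient may be computed in any chart. -/
theorem gradNormSq_eq :
    gradNormSq g h ((extChartAt (𝓡 n) p).symm y)
      = (chartMetric g mem_target_of_mem_chartDomain).pairing r r ⟨(y, t), hy⟩ := by
  have hz := (extChartAt (𝓡 n) p).map_target hy.1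
  have hm := centre_mem_overlapDomain hz hy.2
  rw [gradNormSq_eq_centre g mem_target_of_mem_overlapDomain hm
    (inChart_eq_changeChart hr _), ← (isCoordChange g _ p J).map_pairing,
    changeChart_apply]
  simp only [transition_centre hy.1]

end Pointwise

end Invariance

/-! ### The heat equation in a chart and the general evolution identity -/

section Heat

open TopologicalSpace Filter Topology smoothRing

variable {n : ℕ} {M : Type*} [TopologicalSpace M] [ChartedSpace (EuclideanSpace ℝ (Fin n)) M]
  [IsManifold (𝓡 n) ∞ M] (g : SmoothMetric n M)

/-- A function of time. -/
def timeFun {p : M} {J : Opens ℝ} (a : ℝ → ℝ) (ha : ContDiffOn ℝ ∞ a J) :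
    smoothRing (chartDomain (n := n) p J) :=
  smoothRing.mk (fun x => a x.2) (ha.comp contDiffOn_snd fun _ hx => hx.2)

variable {p : M} {J : Opens ℝ}

omit [IsManifold (𝓡 n) ∞ M] in
theorem mem_time (x : chartDomain (n := n) p J) : x.1.2 ∈ J := x.2.2

theorem ring_identity_apply {O : Opens (EuclideanSpace ℝ (Fin n) × ℝ)}
    {A B Ψ N Q U : smoothRing O} (h : A - B = 2 * Ψ * N * U + 2 * Ψ * Q * U) (x : O) :
    A x - B x = 2 * Ψ x * N x * U x + 2 * Ψ x * Q x * U x := by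
  simpa only [map_sub, map_add, map_mul, map_ofNat, eval_apply] using congrArg (eval x) h

theorem d_timeFun {a : ℝ → ℝ} (ha : ContDiffOn ℝ ∞ a J) (i : Fin n) :
    (chartMetric g (p := p) (O := chartDomain p J) mem_target_of_mem_chartDomain).d i
      (timeFun a ha) = 0 := by
  ext ⟨⟨y, t⟩, hy⟩
  rw [← pd_eq g mem_target_of_mem_chartDomain (h := fun _ => a t) (fun z hz => rfl) i y hy]
  simp [pd]

omit [IsManifold (𝓡 n) ∞ M] in
theorem D_timeFun {a : ℝ → ℝ} (ha : ContDiffOn ℝ ∞ a J)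
    (x : chartDomain (n := n) p J) :
    D (0, 1) (timeFun (p := p) a ha) x = deriv a x.1.2 :=
  (deriv_eq (h := a) (fun _ _ => rfl) _ x.2).symm

theorem D_time_G (i j : Fin n) :
    D (0, 1) ((chartMetric g (p := p) (O := chartDomain p J)
      mem_target_of_mem_chartDomain).G i j) = 0 := by
  ext ⟨⟨y, t⟩, hy⟩
  rw [← deriv_eq (h := fun _ => metricMatrix g p y i j) (fun s hs => rfl) t hy]
  simp

theorem D_time_H (i j : Fin n) :
    D (0, 1) ((chartMetric g (p := p) (O := chartDomain p J)
      mem_target_of_mem_chartDomain).H i j) = 0 := by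
  ext ⟨⟨y, t⟩, hy⟩
  rw [← deriv_eq (h := fun _ => metricInv g p y i j)
    (fun s hs => (chartMetric_H g mem_target_of_mem_chartDomain ⟨(y, s), hs⟩ i j).symm) t hy]
  simp

variable {g} {u : M → ℝ → ℝ}

namespace IsPositiveHeatSolution

variable (hu : IsPositiveHeatSolution g J u)

include hu

theorem contDiffOn (p : M) :
    ContDiffOn ℝ ∞ (fun x : EuclideanSpace ℝ (Fin n) × ℝ =>
      u ((extChartAt (𝓡 n) p).symm x.1) x.2) (chartDomain (n := n) p J) := by
  rw [← contMDiffOn_iff_contDiffOn, modelWithCornersSelf_prod, ← chartedSpaceSelf_prod]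
  have h1 : ContMDiffOn (𝓘(ℝ, EuclideanSpace ℝ (Fin n)).prod 𝓘(ℝ, ℝ)) ((𝓡 n).prod 𝓘(ℝ, ℝ)) ∞
      (fun x : EuclideanSpace ℝ (Fin n) × ℝ => ((extChartAt (𝓡 n) p).symm x.1, x.2))
      (chartDomain (n := n) p J) :=
    ((contMDiffOn_extChartAt_symm (n := ∞) p).comp contMDiffOn_fst fun _ hx => hx.1).prodMk
      contMDiffOn_snd
  exact hu.smooth.comp h1 fun _ hx => ⟨trivial, hx.2⟩

/-- The solution in the chart around `p`. -/
def sol (p : M) : smoothRing (chartDomain (n := n) p J) := smoothRing.mk _ (hu.contDiffOn p)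

/-- Its potential in the chart around `p`. -/
def pot (p : M) : smoothRing (chartDomain (n := n) p J) :=
  smoothRing.mk (fun x => potential u ((extChartAt (𝓡 n) p).symm x.1) x.2)
    ((hu.contDiffOn p).log fun _ hx => (hu.pos _ _ hx.2).ne').neg

theorem D_sol (v : EuclideanSpace ℝ (Fin n) × ℝ) :
    D v (hu.sol p) = -(hu.sol p * D v (hu.pot p)) := by
  ext x
  have hx : (x : EuclideanSpace ℝ (Fin n) × ℝ) ∈ chartDomain (n := n) p J := x.2
  have hpos := (hu.pos ((extChartAt (𝓡 n) p).symm x.1.1) _ hx.2).ne'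
  have hd := (((hu.contDiffOn p).contDiffAt
    ((chartDomain (n := n) p J).isOpen.mem_nhds hx)).differentiableAt (by simp)).hasFDerivAt
  have hl := (hd.log hpos).neg
  rw [ring_neg_apply, ring_mul_apply, D_apply_of_eq (f := hu.sol p)
      (h := fun x => u ((extChartAt (𝓡 n) p).symm x.1) x.2) (fun _ => rfl),
    D_apply_of_eq (f := hu.pot p)
      (h := fun x => potential u ((extChartAt (𝓡 n) p).symm x.1) x.2) (fun _ => rfl)]
  simp only [potential]
  erw [hl.fderiv]
  change _ = -(u _ _ * -((u _ _)⁻¹ * _))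
  field_simp
  rfl

/-- The hypothesis uses a different chart at every point; invariance of the Laplacian turns it into
one identity between functions in the chart of `p`. -/
theorem heat_ring :
    D (0, 1) (hu.sol p) = (chartMetric g mem_target_of_mem_chartDomain).lap (hu.sol p) := by
  ext ⟨⟨y, t⟩, hy⟩
  rw [← laplacian_eq g (h := fun z => u z t) (fun z hz => rfl) hy,
    ← deriv_eq (h := fun s => u ((extChartAt (𝓡 n) p).symm y) s) (fun s hs => rfl) t hy]
  have := hu.heat ((extChartAt (𝓡 n) p).symm y) t hy.2
  rw [heatOp] at this
  linarith

/-- Insert `du = -u df` into the heat equation and cancel the positive factor `u`. -/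
theorem D_pot :
    D (0, 1) (hu.pot p) = (chartMetric g mem_target_of_mem_chartDomain).lap (hu.pot p)
      - (chartMetric g mem_target_of_mem_chartDomain).pairing (hu.pot p) (hu.pot p) := by
  have h := hu.heat_ring (p := p)
  set X := chartMetric g (p := p) (O := chartDomain p J) mem_target_of_mem_chartDomain
  have hd : ∀ i, X.d i (hu.sol p) = -(hu.sol p * X.d i (hu.pot p)) := fun i =>
    hu.D_sol (spaceVec i)
  rw [X.lap_exp_neg hd, hu.D_sol (0, 1)] at h
  ext x
  have hx : (x : EuclideanSpace ℝ (Fin n) × ℝ) ∈ chartDomain (n := n) p J := x.2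
  have hpos : hu.sol p x ≠ 0 := (hu.pos _ _ hx.2).ne'
  have h' := congrArg (fun r : smoothRing (chartDomain (n := n) p J) => r x) h
  simp only [ring_neg_apply, ring_mul_apply, ring_sub_apply] at h' ⊢
  apply mul_left_cancel₀ hpos
  linarith

/-- The evolution of `ψ F u`, over the ring of smooth functions in a chart. -/
theorem heat_harnack_ring {ψ α φ c : ℝ → ℝ} {k : ℝ} (hψ : ContDiffOn ℝ ∞ ψ J)
    (hα : ContDiffOn ℝ ∞ α J) (hφ : ContDiffOn ℝ ∞ φ J) (hc : ContDiffOn ℝ ∞ c J)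
    (hψ' : ∀ t ∈ J, deriv ψ t = ψ t * (4 * c t - 2 * k))
    (hα' : ∀ t ∈ J, deriv (fun s => ψ s * α s) t = 4 * c t * ψ t)
    (hφ' : ∀ t ∈ J, deriv (fun s => ψ s * φ s) t = 2 * n * c t ^ 2 * ψ t)
    {X : CoordMetric n (smoothRing (chartDomain (n := n) p J))}
    (hX : X = chartMetric g mem_target_of_mem_chartDomain) :
    X.lap (timeFun ψ hψ * (X.pairing (hu.pot p) (hu.pot p)
          + timeFun α hα * D (0, 1) (hu.pot p) - timeFun φ hφ) * hu.sol p)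
        - D (0, 1) (timeFun ψ hψ * (X.pairing (hu.pot p) (hu.pot p)
          + timeFun α hα * D (0, 1) (hu.pot p) - timeFun φ hφ) * hu.sol p)
      = 2 * timeFun ψ hψ * X.normSq (X.hess (hu.pot p) - timeFun (n := n) (p := p) c hc • X.G) * hu.sol p
        + 2 * timeFun ψ hψ * (∑ i, ∑ j, (X.ric i j + algebraMap ℝ _ k * X.G i j)
          * X.grad (hu.pot p) i * X.grad (hu.pot p) j) * hu.sol p := by
  have h1 : D (0, 1) (timeFun (n := n) (p := p) ψ hψ)
      = timeFun ψ hψ * (4 * timeFun c hc - 2 * algebraMap ℝ _ k) := by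
    ext q
    rw [D_timeFun, hψ' _ (mem_time q)]
    rfl
  have h2 : D (0, 1) (timeFun (n := n) (p := p) ψ hψ * timeFun α hα)
      = 4 * timeFun (n := n) (p := p) c hc * timeFun ψ hψ := by
    ext q
    -- A product of functions of time is again one, so its derivative is the ordinary one.
    change D (0, 1) (timeFun _ (hψ.mul hα)) q = _
    rw [D_timeFun]
    exact hα' _ (mem_time q)
  have h3 : D (0, 1) (timeFun (n := n) (p := p) ψ hψ * timeFun φ hφ)
      = 2 * (n : smoothRing (chartDomain (n := n) p J)) * timeFun c hc ^ 2 * timeFun ψ hψ := by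
    ext q
    change D (0, 1) (timeFun _ (hψ.mul hφ)) q = _
    rw [D_timeFun]
    refine (hφ' _ (mem_time q)).trans ?_
    rw [← eval_apply, map_mul, map_mul, map_mul, map_pow, map_natCast, map_ofNat]
    rfl
  subst hX
  exact (chartMetric g (p := p) (O := chartDomain p J)
    mem_target_of_mem_chartDomain).heat_harnack (D := D (0, 1)) (fun i r => D_comm _ _ r) (D_time_G g) (D_time_H g)
    (fun i => hu.D_sol (spaceVec i)) (hu.D_sol (0, 1)) hu.D_pot
    (d_timeFun g hψ) (d_timeFun g hα) (d_timeFun g hφ) h1 h2 h3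

/-- `F` is defined with a new chart at each point; invariance of `|∇f|²` makes `ψFu` a single smooth
function in the chart of `p`, which can then be differentiated. -/
theorem harnackF_eq {ψ α φ : ℝ → ℝ} (hψ : ContDiffOn ℝ ∞ ψ J)
    (hα : ContDiffOn ℝ ∞ α J) (hφ : ContDiffOn ℝ ∞ φ J)
    {X : CoordMetric n (smoothRing (chartDomain (n := n) p J))}
    (hX : X = chartMetric g mem_target_of_mem_chartDomain) (s : ℝ)
    (y : EuclideanSpace ℝ (Fin n)) (hy : (y, s) ∈ chartDomain (n := n) p J) :
    ψ s * harnackF g α φ u ((extChartAt (𝓡 n) p).symm y) s * u ((extChartAt (𝓡 n) p).symm y) s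
      = (timeFun ψ hψ * (X.pairing (hu.pot p) (hu.pot p)
          + timeFun α hα * D (0, 1) (hu.pot p) - timeFun φ hφ) * hu.sol p :
            smoothRing (chartDomain (n := n) p J)) ⟨(y, s), hy⟩ := by
  subst hX
  simp only [ring_mul_apply, ring_sub_apply, ring_add_apply, harnackF]
  rw [gradNormSq_eq g (r := hu.pot p) (fun _ _ => rfl) hy,
    deriv_eq (r := hu.pot p) (y := y) (fun s hs => rfl) s hy]
  rfl

/-- The evolution of `ψ F u` for general time functions. -/
theorem heatOp_harnack {ψ α φ c : ℝ → ℝ} {k : ℝ} (hψ : ContDiffOn ℝ ∞ ψ J)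
    (hα : ContDiffOn ℝ ∞ α J) (hφ : ContDiffOn ℝ ∞ φ J) (hc : ContDiffOn ℝ ∞ c J)
    (hψ' : ∀ t ∈ J, deriv ψ t = ψ t * (4 * c t - 2 * k))
    (hα' : ∀ t ∈ J, deriv (fun s => ψ s * α s) t = 4 * c t * ψ t)
    (hφ' : ∀ t ∈ J, deriv (fun s => ψ s * φ s) t = 2 * n * c t ^ 2 * ψ t)
    (x : M) {t : ℝ} (ht : t ∈ J) :
    heatOp g (fun z s => ψ s * harnackF g α φ u z s * u z s) x t
      = 2 * ψ t * tensorNormSq g x (fun i j =>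
          hess g (fun z => potential u z t) x i j - c t * gLow g x i j) * u x t
        + 2 * ψ t * ricciShiftGrad g k (fun z => potential u z t) x * u x t := by
  obtain ⟨X, hX⟩ : ∃ X, X = chartMetric g (p := x) (O := chartDomain x J)
    mem_target_of_mem_chartDomain := ⟨_, rfl⟩
  have hxt : (extChartAt (𝓡 n) x x, t) ∈ chartDomain (n := n) x J :=
    ⟨mem_extChartAt_target x, ht⟩
  have key := ring_identity_apply (hu.heat_harnack_ring hψ hα hφ hc hψ' hα' hφ' hX) ⟨_, hxt⟩
  have hF := hu.harnackF_eq hψ hα hφ hX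
  have hf : ∀ y (hy : (y, t) ∈ chartDomain (n := n) x J),
      inChart x (fun z => potential u z t) y = hu.pot x ⟨(y, t), hy⟩ := fun _ _ => rfl
  have e1 := laplacian_eq g (h := fun z => ψ t * harnackF g α φ u z t * u z t) (hF t) hxt
  have e2 := deriv_eq (fun s hs => hF s _ hs) t hxt
  have e3 := tensorNormSq_eq g mem_target_of_mem_chartDomain hxt
    (A := fun i j => hess g (fun z => potential u z t) x i j - c t * gLow g x i j)
    (B := X.hess (hu.pot x) - timeFun (n := n) (p := x) c hc • X.G) (fun i j => by
      rw [hess_eq g mem_target_of_mem_chartDomain hxt hf,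
        gLow_eq g mem_target_of_mem_chartDomain hxt, Matrix.sub_apply, Matrix.smul_apply,
        smul_eq_mul, ring_sub_apply, ring_mul_apply, hX]
      rfl)
  have e4 := ricciShiftGrad_eq g mem_target_of_mem_chartDomain hxt hf k
  have hux : hu.sol x ⟨_, hxt⟩ = u x t := by
    change u ((extChartAt (𝓡 n) x).symm (extChartAt (𝓡 n) x x)) t = u x t
    rw [extChartAt_to_inv]
  rw [extChartAt_to_inv] at e1 e2
  rw [← hX] at e1 e3 e4
  rw [heatOp, e1, e2, e3, e4, ← hux]
  exact key

end IsPositiveHeatSolution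

end Heat

/-! ### The differential equations for the time factors -/

section TimeFunctions

variable {n : ℕ} {k t : ℝ}

theorem deriv_sq_mul_alphaLin :
    deriv (fun s => s ^ 2 * alphaLin k s) t = 2 * t + 2 * k * t ^ 2 := by
  have h : HasDerivAt (fun s => s ^ 2 * alphaLin k s)
      ((2 : ℕ) * t ^ (2 - 1) * 1 * (1 + 2 / 3 * k * t) + t ^ 2 * (2 / 3 * k * 1)) t :=
    ((hasDerivAt_id t).pow 2).mul (((hasDerivAt_id t).const_mul (2 / 3 * k)).const_add 1)
  rw [h.deriv]
  push_cast
  ring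

theorem deriv_sq_mul_phiLin :
    deriv (fun s => s ^ 2 * phiLin n k s) t = n / 2 * (1 + k * t) ^ 2 := by
  -- The equality is global: at `s = 0` both sides vanish, as `s ^ 2` kills the default value of the
  -- quotient.
  have he : (fun s => s ^ 2 * phiLin n k s)
      = fun s => n / 2 * s + n / 2 * k * s ^ 2 + n / 6 * k ^ 2 * s ^ 3 := by
    ext s
    by_cases hs : s = 0
    · simp [hs]
    · simp only [phiLin]
      field_simp
  have h : HasDerivAt (fun s : ℝ => n / 2 * s + n / 2 * k * s ^ 2 + n / 6 * k ^ 2 * s ^ 3)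
      (n / 2 * 1 + n / 2 * k * ((2 : ℕ) * t ^ (2 - 1) * 1)
        + n / 6 * k ^ 2 * ((3 : ℕ) * t ^ (3 - 1) * 1)) t :=
    (((hasDerivAt_id t).const_mul (n / 2 : ℝ)).add
      (((hasDerivAt_id t).pow 2).const_mul (n / 2 * k : ℝ))).add
      (((hasDerivAt_id t).pow 3).const_mul (n / 6 * k ^ 2 : ℝ))
  rw [he, h.deriv]
  push_cast
  ring

theorem hasDerivAt_sinh_mul (k t : ℝ) :
    HasDerivAt (fun s => Real.sinh (k * s)) (Real.cosh (k * t) * k) t := by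
  simpa using ((hasDerivAt_id t).const_mul k).sinh

theorem hasDerivAt_cosh_mul (k t : ℝ) :
    HasDerivAt (fun s => Real.cosh (k * s)) (Real.sinh (k * t) * k) t := by
  simpa using ((hasDerivAt_id t).const_mul k).cosh

theorem deriv_sinh_sq :
    deriv (fun s => Real.sinh (k * s) ^ 2) t = 2 * k * Real.sinh (k * t) * Real.cosh (k * t) := by
  rw [((hasDerivAt_sinh_mul k t).fun_pow 2).deriv]
  push_cast
  ring

theorem deriv_sinh_sq_mul_alphaHyp :
    deriv (fun s => Real.sinh (k * s) ^ 2 * alphaHyp k s) t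
      = 2 * k * Real.sinh (k * t) * (Real.cosh (k * t) + Real.sinh (k * t)) := by
  have he : (fun s => Real.sinh (k * s) ^ 2 * alphaHyp k s)
      = fun s => Real.sinh (k * s) ^ 2 + (Real.cosh (k * s) * Real.sinh (k * s) - k * s) := by
    ext s
    by_cases hs : Real.sinh (k * s) = 0
    -- The term `k * s` survives on the right, so the zero of `sinh` must be traced back to `k * s =
    -- 0`.
    · rw [Real.sinh_eq_zero.1 hs]
      simp
    · simp only [alphaHyp]
      field_simp
  have h := ((hasDerivAt_sinh_mul k t).fun_pow 2).fun_add
    (((hasDerivAt_cosh_mul k t).fun_mul (hasDerivAt_sinh_mul k t)).fun_sub ((hasDerivAt_id' t).const_mul k))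
  rw [he, h.deriv]
  push_cast
  linear_combination k * Real.cosh_sq (k * t)

theorem deriv_sinh_sq_mul_phiHyp :
    deriv (fun s => Real.sinh (k * s) ^ 2 * phiHyp n k s) t
      = n * k ^ 2 / 2 * (Real.cosh (k * t) + Real.sinh (k * t)) ^ 2 := by
  have he : (fun s => Real.sinh (k * s) ^ 2 * phiHyp n k s)
      = fun s => n * k / 2 * (Real.cosh (k * s) * Real.sinh (k * s) + Real.sinh (k * s) ^ 2) := by
    ext s
    by_cases hs : Real.sinh (k * s) = 0
    · simp [hs]
    · simp only [phiHyp]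
      field_simp
  have h := (((hasDerivAt_cosh_mul k t).fun_mul (hasDerivAt_sinh_mul k t)).fun_add
    ((hasDerivAt_sinh_mul k t).fun_pow 2)).const_mul (n * k / 2 : ℝ)
  rw [he, h.deriv]
  push_cast
  ring

end TimeFunctions

end HeatHarnack

end

theorem proposition2p1 {n : ℕ} (hn : 0 < n) {M : Type*} [TopologicalSpace M]
    [ChartedSpace (EuclideanSpace ℝ (Fin n)) M] [IsManifold (𝓡 n) ∞ M]
    (g : HeatHarnack.SmoothMetric n M) (k : ℝ) (J : Set ℝ) (hJ : IsOpen J) (hJpos : J ⊆ Set.Ioi 0)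
    (u : M → ℝ → ℝ) (hu : HeatHarnack.IsPositiveHeatSolution g J u) :
    (∀ x, ∀ t ∈ J,
      HeatHarnack.heatOp g (fun z s => s ^ 2 *
          HeatHarnack.harnackF g (HeatHarnack.alphaLin k) (HeatHarnack.phiLin n k) u z s * u z s)
          x t
        = 2 * t ^ 2 * HeatHarnack.tensorNormSq g x (fun i j =>
              HeatHarnack.hess g (fun z => HeatHarnack.potential u z t) x i j
                - 1 / (2 * t) * HeatHarnack.gLow g x i j - k / 2 * HeatHarnack.gLow g x i j)
            * u x t
          + 2 * t ^ 2 * HeatHarnack.ricciShiftGrad g k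
              (fun z => HeatHarnack.potential u z t) x * u x t)
    ∧ (k ≠ 0 → ∀ x, ∀ t ∈ J,
      HeatHarnack.heatOp g (fun z s => Real.sinh (k * s) ^ 2 *
          HeatHarnack.harnackF g (HeatHarnack.alphaHyp k) (HeatHarnack.phiHyp n k) u z s * u z s)
          x t
        = 2 * Real.sinh (k * t) ^ 2 * HeatHarnack.tensorNormSq g x (fun i j =>
              HeatHarnack.hess g (fun z => HeatHarnack.potential u z t) x i j
                - HeatHarnack.phiHyp n k t / n * HeatHarnack.gLow g x i j)
            * u x t
          + 2 * Real.sinh (k * t) ^ 2 * HeatHarnack.ricciShiftGrad g k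
              (fun z => HeatHarnack.potential u z t) x * u x t) := by
  have hu' : HeatHarnack.IsPositiveHeatSolution g ((⟨J, hJ⟩ : TopologicalSpace.Opens ℝ) : Set ℝ) u :=
    hu
  have hne : ∀ t ∈ J, t ≠ 0 := fun t ht => (show (0 : ℝ) < t from hJpos ht).ne'
  constructor
  · intro x t ht
    -- This `c` is forced by `ψ' = (4c - 2k)ψ` with `ψ = t²`.
    have hc : ContDiffOn ℝ ∞ (fun s : ℝ => 1 / (2 * s) + k / 2) J :=
      (contDiffOn_const.div (contDiffOn_const.mul contDiffOn_id)
        fun s hs => mul_ne_zero two_ne_zero (hne s hs)).add contDiffOn_const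
    have hα : ContDiffOn ℝ ∞ (HeatHarnack.alphaLin k) J := by
      unfold HeatHarnack.alphaLin
      fun_prop
    have hφ : ContDiffOn ℝ ∞ (HeatHarnack.phiLin n k) J :=
      ((contDiffOn_const.div (contDiffOn_const.mul contDiffOn_id)
        fun s hs => mul_ne_zero two_ne_zero (hne s hs)).add contDiffOn_const).add
        (contDiffOn_const.mul contDiffOn_id)
    have h := hu'.heatOp_harnack (ψ := fun s => s ^ 2) (k := k) (contDiffOn_id.pow 2) hα hφ hc
      (fun s hs => by
        have := hne s hs
        simp
        field_simp
        ring)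
      (fun s hs => by
        have := hne s hs
        rw [HeatHarnack.deriv_sq_mul_alphaLin]
        field_simp
        ring)
      (fun s hs => by
        have := hne s hs
        rw [HeatHarnack.deriv_sq_mul_phiLin]
        field_simp) x ht
    simpa only [add_mul, sub_sub] using h
  · intro hk x t ht
    have hn' : (n : ℝ) ≠ 0 := by exact_mod_cast hn.ne'
    have hs0 : ∀ s ∈ J, Real.sinh (k * s) ≠ 0 := fun s hs h =>
      mul_ne_zero hk (hne s hs) (Real.sinh_eq_zero.1 h)
    have hsinh : ContDiffOn ℝ ∞ (fun s => Real.sinh (k * s)) J :=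
      (Real.contDiff_sinh.comp (contDiff_const.mul contDiff_id)).contDiffOn
    have hcosh : ContDiffOn ℝ ∞ (fun s => Real.cosh (k * s)) J :=
      (Real.contDiff_cosh.comp (contDiff_const.mul contDiff_id)).contDiffOn
    have hα : ContDiffOn ℝ ∞ (HeatHarnack.alphaHyp k) J :=
      contDiffOn_const.add (((hcosh.mul hsinh).sub (contDiffOn_const.mul contDiffOn_id)).div
        (hsinh.pow 2) fun s hs => pow_ne_zero 2 (hs0 s hs))
    have hφ : ContDiffOn ℝ ∞ (HeatHarnack.phiHyp n k) J :=
      contDiffOn_const.mul ((hcosh.div hsinh hs0).add contDiffOn_const)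
    exact hu'.heatOp_harnack (ψ := fun s => Real.sinh (k * s) ^ 2) (k := k) (hsinh.pow 2) hα hφ
      -- For `ψ = sinh²(kt)` the equation `ψ' = (4c - 2k)ψ` forces `c = (k/2)(coth(kt) + 1)`, which
      -- is `φ/n`.
      (c := fun s => HeatHarnack.phiHyp n k s / n) (hφ.div_const _)
      (fun s hs => by
        have := hs0 s hs
        rw [HeatHarnack.deriv_sinh_sq]
        simp only [HeatHarnack.phiHyp]
        field_simp
        ring)
      (fun s hs => by
        have := hs0 s hs
        rw [HeatHarnack.deriv_sinh_sq_mul_alphaHyp]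
        simp only [HeatHarnack.phiHyp]
        field_simp
        ring)
      (fun s hs => by
        have := hs0 s hs
        rw [HeatHarnack.deriv_sinh_sq_mul_phiHyp]
        simp only [HeatHarnack.phiHyp]
        field_simp) x ht
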